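/- \textbf{Setting.} Let $\Sigma$ be an order-sorted signature with sorts $\mathsf{Msg}$ (messages) and $\mathsf{Fresh}$. Variables of sort $\mathsf{Fresh}$ are the \emph{fresh variables}; $\rho_{ro,i}$ sends each fresh variable $r$ to a constant $r.ro.i$ of sort $\mathsf{Fresh}$, its value in session $i$ of role $ro$. Symbolic terms are built from $\Sigma$ and variables, ground terms from $\Sigma$ and the constants $r.ro.i$. Substitutions preserve sorts. A \emph{protocol} $\mathcal P$ consists of a set $E$ of $\Sigma$-equations, with induced congruence $=_E$ on terms, and a set of strands $(ro)[u_1,\dots,u_n]$, where $ro$ is a role and each $u_k$ is a sent message $m^+$, a received message $m^-$, or a constrained message $\{T,num\}$ with $num\in\mathbb N$ and $T$ one of $?$, $m=m'$, $m\ne m'$. Several strands may share a role. No strand begins with a constrained message whose constraint is an equality or a disequality. $=_E$ is extended to strands and facts. \textbf{Forwards semantics.} A \emph{ground strand state} is a multiset of strands $(ro,i)[v_1,\dots,v_k]$, each modulo $E$ a ground instance of an initial segment of a strand of $\mathcal P$ of role $ro$, together with a multiset of ground messages, the intruder knowledge. It is \emph{initial} if all its strands are empty and the knowledge is empty. A step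 $s\to s'$ takes a strand $(ro)[u_1,\dots,u_n]$ of $\mathcal P$, an index $j$, and a ground substitution $\tau$ extending $\rho_{ro,i}$. If $j>1$, it replaces a strand $(ro,i)[v_1,\dots,v_{j-1}]$ of $s$ with $v_k=_E u_k\tau$ for all $k<j$ by $(ro,i)[v_1,\dots,v_{j-1},u_j\tau]$. If $j=1$, it adds $(ro,i)[u_1\tau]$, where $i$ is one more than the largest identifier of a strand of role $ro$ in $s$ (or $1$ if there is none). If $u_j\tau=m^-$, then $m$ must be known modulo $E$. If $u_j\tau=m^+$, then $m$ is added to the knowledge, provided that it is not yet known modulo $E$, or else the knowledge is left unchanged (always permitted). If $u_j\tau=\{T,num\}$ with $T$ an equality or disequality, then $j>1$ and $T$ must hold modulo $E$; if $T$ is $?$ there is no condition. \textbf{Backwards semantics.} A \emph{constrained symbolic strand state} $\mathit{CstrS}=\langle S,\Psi\rangle$ consists of a multiset of strands $(ro)\,{::}r_1,\dots,r_m{::}\,[u_1,\dots,u_{i-1}\mid u_i,\dots,u_n]$ and a state variable $SS$ for further strands, a multiset of facts $m\in\mathcal I$ (known) and $m\notin\mathcal I$ (not yet known) and a state variable $IK$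 for further facts, and a finite conjunction $\Psi$ of disequalities between messages. Each of its strands is modulo $E$ an instance of a strand of $\mathcal P$ of the same role under a substitution that renames the fresh variables of that strand bijectively to $r_1,\dots,r_m$, and different strands of the state have disjoint lists of fresh variables. It is \emph{initial} if every bar is at the beginning and no fact $m\in\mathcal I$ occurs. Consider the following rules, written forwards, for the strands and facts that change: \begin{itemize} \item[(B$-$)] $[L\mid M^-,L']\ \&\ \{M\in\mathcal I\}\ \to\ [L,M^-\mid L']\ \&\ \{M\in\mathcal I\}$; \item[(B$+$)] $[L\mid M^+,L']\ \to\ [L,M^+\mid L']$; \item[(B$++$)] $[L\mid M^+,L']\ \&\ \{M\notin\mathcal I\}\ \to\ [L,M^+\mid L']\ \&\ \{M\in\mathcal I\}$; \item[(B\&)] $[l_1\mid u^+,l_2]\ \&\ \{u\notin\mathcal I\}\ \to\ \{u\in\mathcal I\}$, for each properly renamed strand $[l_1,u^+,l_2]$ of $\mathcal P$; \item[(B?)] $[L\mid\{?,num\},L']\ \to\ [L,\{?,num\}\mid L']$; \item[(Bif$=$)] $[L\mid\{M=M,num\},L']\ \to\ [L,\{M=M,num\}\mid L']$; \item[(Bif$\ne$)]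 $\langle[L\mid\{M\ne M',num\},L'],\ \Psi\wedge M\ne M'\rangle\ \to\ \langle[L,\{M\ne M',num\}\mid L'],\ \Psi\rangle$ if $\Psi\wedge M\neq_E M'$ is satisfiable. \end{itemize} A backwards step from $\mathit{CstrS}'$ to a constrained symbolic strand state $\mathit{CstrS}$ is narrowing with a reversed rule: some instance of $\mathit{CstrS}'$ (also of its state variables) is, modulo $E$, the right-hand side of a rule instance with left-hand side $\mathit{CstrS}$. Fresh variables stand for values and are never instantiated by the unifier. The forward direction of a (B$++$) or (B\&) step \emph{learns} the instance of $M$ or of $u$. Write $\mathit{CstrS}_0\stackrel{*}{\leftsquigarrow}_\mu\mathit{CstrS}'$ if $\mathit{CstrS}_0$ is obtained from $\mathit{CstrS}'$ by finitely many (possibly no) backwards steps with composed substitution $\mu$. \textbf{Instantiation.} For a ground substitution $\theta$, $\mathit{CstrS}=\langle S,\Psi\rangle$ \emph{instantiates} to $s$, written $\mathit{CstrS}>^\theta s$, if: for each strand $(ro)[u_1,\dots,u_{i-1}\mid\dots]$ of $S$ with $i>1$ there is a strand $(ro,k)[v_1,\dots,v_{i-1}]$ in $s$ with $v_j=_E u_j\theta$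 for all $j<i$; for each fact $w\in\mathcal I$ of $S$, $w\theta$ is known in $s$ modulo $E$; for each fact $w\notin\mathcal I$ of $S$, $w\theta$ is not known in $s$ modulo $E$; and $u\theta\neq_E v\theta$ for each disequality $u\ne v$ of $\Psi$. \textbf{Theorem (Soundness).} Let $\mathcal P$ be a protocol, $\mathit{CstrS}_0,\mathit{CstrS}'$ constrained symbolic strand states, $s_0$ an initial ground strand state and $\theta$ a ground substitution such that (i) $\mathit{CstrS}_0$ is initial, (ii) $\mathit{CstrS}_0\stackrel{*}{\leftsquigarrow}_\mu\mathit{CstrS}'$, (iii) $\mathit{CstrS}_0>^\theta s_0$, and (iv) the negative facts of $\mathit{CstrS}'$ (if it has any) are not contradicted along the sequence in (ii): for each fact $w\notin\mathcal I$ of $\mathit{CstrS}'$ and each message $k$ learned along that sequence (instantiated by the substitutions of the subsequent backwards steps), $w\mu\theta\neq_E k\theta$. Then there are a ground strand state $s'$ and a ground substitution $\theta'$ such that $s_0\to^*s'$ and $\mathit{CstrS}'>^{\theta'}s'$. -/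

import Mathlib

set_option linter.checkUnivs false
universe u v w r

/-- An order-sorted signature: a poset of sorts, operators with (possibly several,
subsort-overloaded) ranks, and the two distinguished sorts of messages and of fresh values. -/
structure Signature where
  Srt : Type u
  order : PartialOrder Srt
  Op : Type v
  arity : Op → ℕ
  /-- the declared ranks `f : s₁ … sₙ → s` -/
  rank : (f : Op) → Set ((Fin (arity f) → Srt) × Srt)
  msg : Srt
  fresh : Srt

attribute [instance] Signature.order

/-- Raw terms with leaves in `V` (variables, or constants for fresh values). -/
inductive Term (Sg : Signature.{u, v}) (V : Type w) : Type (max v w) where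
  | leaf (x : V) : Term Sg V
  | app (f : Sg.Op) (args : Fin (Sg.arity f) → Term Sg V) : Term Sg V

/-- The sort of each leaf. -/
class SortedLeaves (Sg : Signature.{u, v}) (V : Type w) where
  srt : V → Sg.Srt

/-- Sorted variables, countably many of each sort.
Those of sort `fresh` are the fresh variables. -/
structure Var (Sg : Signature.{u, v}) where
  sort : Sg.Srt
  idx : ℕ

/-- The constant `r.ro.i`: the value that the `r`-th fresh variable takes in the `i`-th session
of role `ro`. -/
structure Name (Role : Type r) where
  fvar : ℕ
  role : Role
  id : ℕ

instance (Sg : Signature.{u, v}) : SortedLeaves Sg (Var Sg) := ⟨Var.sort⟩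

instance (Sg : Signature.{u, v}) (Role : Type r) : SortedLeaves Sg (Name Role) :=
  ⟨fun _ => Sg.fresh⟩

/-- The `n`-th fresh variable. -/
def Var.ofFresh (Sg : Signature.{u, v}) (n : ℕ) : Var Sg := ⟨Sg.fresh, n⟩

/-- Symbolic terms: terms with variables. -/
abbrev STerm (Sg : Signature.{u, v}) := Term Sg (Var Sg)

/-- Ground terms: no variables; the only leaves are the constants `r.ro.i`. -/
abbrev GTerm (Sg : Signature.{u, v}) (Role : Type r) := Term Sg (Name Role)

section Terms

variable {Sg : Signature.{u, v}}

/-- Application of a substitution. -/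
def Term.bind {V W : Type*} (σ : V → Term Sg W) : Term Sg V → Term Sg W
  | .leaf x => σ x
  | .app f args => .app f (fun i => (args i).bind σ)

/-- The set of leaves of a term. -/
def Term.leaves {V : Type*} : Term Sg V → Set V
  | .leaf x => {x}
  | .app _ args => ⋃ i, (args i).leaves

/-- `HasSort t s`: the term `t` is well formed and has sort `s`. -/
inductive HasSort {V : Type*} [SortedLeaves Sg V] : Term Sg V → Sg.Srt → Prop
  | leaf (x : V) (s : Sg.Srt) : SortedLeaves.srt x ≤ s → HasSort (.leaf x) s
  | app (f : Sg.Op) (args : Fin (Sg.arity f) → Term Sg V)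
      (a : Fin (Sg.arity f) → Sg.Srt) (s s' : Sg.Srt) :
      (a, s) ∈ Sg.rank f → (∀ i, HasSort (args i) (a i)) → s ≤ s' → HasSort (.app f args) s'

/-- Sort-preserving substitutions. -/
def IsSorted {V W : Type*} [SortedLeaves Sg V] [SortedLeaves Sg W] (σ : V → Term Sg W) : Prop :=
  ∀ x, HasSort (σ x) (SortedLeaves.srt x)

/-- Order-sorted equational deduction `t =_E t'`. -/
inductive EqE (E : Set (STerm Sg × STerm Sg)) {V : Type*} [SortedLeaves Sg V] :
    Term Sg V → Term Sg V → Prop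
  | refl (t : Term Sg V) : EqE E t t
  | symm {t t' : Term Sg V} : EqE E t t' → EqE E t' t
  | trans {t t' t'' : Term Sg V} : EqE E t t' → EqE E t' t'' → EqE E t t''
  | inst (l r' : STerm Sg) (σ : Var Sg → Term Sg V) :
      (l, r') ∈ E → IsSorted σ → EqE E (l.bind σ) (r'.bind σ)
  | congr (f : Sg.Op) (args args' : Fin (Sg.arity f) → Term Sg V)
      (a : Fin (Sg.arity f) → Sg.Srt) (s : Sg.Srt) :
      (a, s) ∈ Sg.rank f → (∀ i, HasSort (args i) (a i)) → (∀ i, HasSort (args' i) (a i)) →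
      (∀ i, EqE E (args i) (args' i)) → EqE E (.app f args) (.app f args')

end Terms

/-- Constraints: explicit nondeterministic choice `?`, equality, disequality. -/
inductive Cstr (T : Type*) where
  | nondet : Cstr T
  | eq (a b : T) : Cstr T
  | ne (a b : T) : Cstr T

/-- The elements of a strand: sent messages `+m`, received messages `-m`, and
constrained messages `{Cstr, Num}`. -/
inductive SMsg (T : Type*) where
  | out (m : T) : SMsg T
  | inp (m : T) : SMsg T
  | cstr (c : Cstr T) (num : ℕ) : SMsg T

/-- Intruder facts: `pos m` is `m ∈ I` (known), `neg m` is `m ∉ I` (not yet known). -/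
inductive IFact (T : Type*) where
  | pos (m : T) : IFact T
  | neg (m : T) : IFact T

section Lift

variable {T T' : Type*}

def Cstr.map (f : T → T') : Cstr T → Cstr T'
  | .nondet => .nondet
  | .eq a b => .eq (f a) (f b)
  | .ne a b => .ne (f a) (f b)

def SMsg.map (f : T → T') : SMsg T → SMsg T'
  | .out m => .out (f m)
  | .inp m => .inp (f m)
  | .cstr c n => .cstr (c.map f) n

def IFact.map (f : T → T') : IFact T → IFact T'
  | .pos m => .pos (f m)
  | .neg m => .neg (f m)

/-- The messages inside a strand element. -/
def SMsg.terms : SMsg T → Set T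
  | .out m => {m}
  | .inp m => {m}
  | .cstr .nondet _ => ∅
  | .cstr (.eq a b) _ => {a, b}
  | .cstr (.ne a b) _ => {a, b}

/-- The message of a fact. -/
def IFact.term : IFact T → T
  | .pos m => m
  | .neg m => m

/-- The extension of a relation on messages to constraints, strand elements, facts. -/
inductive Cstr.Rel (R : T → T → Prop) : Cstr T → Cstr T → Prop
  | nondet : Cstr.Rel R .nondet .nondet
  | eq {a b a' b' : T} : R a a' → R b b' → Cstr.Rel R (.eq a b) (.eq a' b')
  | ne {a b a' b' : T} : R a a' → R b b' → Cstr.Rel R (.ne a b) (.ne a' b')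

inductive SMsg.Rel (R : T → T → Prop) : SMsg T → SMsg T → Prop
  | out {m m' : T} : R m m' → SMsg.Rel R (.out m) (.out m')
  | inp {m m' : T} : R m m' → SMsg.Rel R (.inp m) (.inp m')
  | cstr {c c' : Cstr T} (n : ℕ) : Cstr.Rel R c c' → SMsg.Rel R (.cstr c n) (.cstr c' n)

inductive IFact.Rel (R : T → T → Prop) : IFact T → IFact T → Prop
  | pos {m m' : T} : R m m' → IFact.Rel R (.pos m) (.pos m')
  | neg {m m' : T} : R m m' → IFact.Rel R (.neg m) (.neg m')

end Lift

/-- A protocol: equations `E` between terms of a common sort and a set of role-labelled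
constrained strands. Several strands may carry the same role (one for each execution path).
No strand starts with an equality or disequality constraint, as well-formedness demands. -/
structure Protocol (Sg : Signature.{u, v}) (Role : Type r) where
  eqs : Set (STerm Sg × STerm Sg)
  eqs_sorted : ∀ e ∈ eqs, ∃ s, HasSort e.1 s ∧ HasSort e.2 s
  strands : Set (Role × List (SMsg (STerm Sg)))
  strands_msg : ∀ p ∈ strands, ∀ x ∈ p.2, ∀ t ∈ x.terms, HasSort t Sg.msg
  strands_head : ∀ (ro : Role) (c : Cstr (STerm Sg)) (num : ℕ) (l : List (SMsg (STerm Sg))),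
    (ro, .cstr c num :: l) ∈ strands → c = .nondet

/-- A symbolic strand `(ro) :: r₁,…,rₘ :: [past | future]`;
`fresh` holds the indices of its own fresh variables `r₁,…,rₘ`. -/
structure SStrand (Sg : Signature.{u, v}) (Role : Type r) where
  role : Role
  fresh : Finset ℕ
  past : List (SMsg (STerm Sg))
  future : List (SMsg (STerm Sg))

/-- A constrained symbolic state `⟨{strands & SS & {facts, IK}}, Ψ⟩`. The variables `SS` and `IK`
for further strands and further facts are always present, and left implicit.
`Ψ` is the conjunction of the disequalities `u ≠ v` for the pairs `(u, v)` in `store`. -/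
structure CState (Sg : Signature.{u, v}) (Role : Type r) where
  strands : Multiset (SStrand Sg Role)
  facts : Multiset (IFact (STerm Sg))
  store : Multiset (STerm Sg × STerm Sg)

/-- A partially executed ground strand `(ro, i)[v₁, …, vₖ]`. -/
structure GStrand (Sg : Signature.{u, v}) (Role : Type r) where
  role : Role
  id : ℕ
  msgs : List (SMsg (GTerm Sg Role))

/-- A ground state: ground strands, and the messages known to the intruder. -/
structure GState (Sg : Signature.{u, v}) (Role : Type r) where
  strands : Multiset (GStrand Sg Role)
  ik : Multiset (GTerm Sg Role)

section Symbolic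

variable {Sg : Signature.{u, v}} {Role : Type r}

/-- The fresh variables that occur in a list of strand elements. -/
def freshIdx (l : List (SMsg (STerm Sg))) : Set ℕ :=
  {n | ∃ x ∈ l, ∃ t ∈ x.terms, Var.ofFresh Sg n ∈ t.leaves}

/-- `ρ` renames the fresh variables of `l` injectively to the fresh variables in `fr`:
fresh variables are names of values and are never instantiated by other terms. -/
def FreshRenaming (l : List (SMsg (STerm Sg))) (ρ : Var Sg → STerm Sg) (fr : Finset ℕ) : Prop :=
  ∃ φ : ℕ → ℕ, Set.InjOn φ (freshIdx l) ∧ φ '' freshIdx l = ↑fr ∧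
    ∀ n ∈ freshIdx l, ρ (Var.ofFresh Sg n) = .leaf (Var.ofFresh Sg (φ n))

/-- `st` is, modulo `E`, an instance of a strand of the protocol. -/
def SStrand.IsInstance (P : Protocol Sg Role) (st : SStrand Sg Role) : Prop :=
  ∃ (l : List (SMsg (STerm Sg))) (ρ : Var Sg → STerm Sg),
    (st.role, l) ∈ P.strands ∧ IsSorted ρ ∧ FreshRenaming l ρ st.fresh ∧
    List.Forall₂ (SMsg.Rel (EqE P.eqs)) (l.map (SMsg.map (Term.bind ρ))) (st.past ++ st.future)

/-- Constrained symbolic strand states of `P`. Distinct strands have disjoint sets of fresh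
variables, as they stand for distinct sessions. -/
structure CState.IsSymbolic (P : Protocol Sg Role) (C : CState Sg Role) : Prop where
  inst : ∀ st ∈ C.strands, st.IsInstance P
  fresh_disjoint : (C.strands.bind fun st => st.fresh.val).Nodup
  facts_msg : ∀ f ∈ C.facts, HasSort f.term Sg.msg
  store_msg : ∀ d ∈ C.store, HasSort d.1 Sg.msg ∧ HasSort d.2 Sg.msg

/-- Initial symbolic states: every bar is at the beginning and nothing is known. -/
def CState.IsInitial (C : CState Sg Role) : Prop :=
  (∀ st ∈ C.strands, st.past = []) ∧ ∀ m, IFact.pos m ∉ C.facts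

/-- Satisfiability of a conjunction of disequalities in the free algebra modulo `E`. -/
def Satisfiable (E : Set (STerm Sg × STerm Sg)) (Ψ : Multiset (STerm Sg × STerm Sg)) : Prop :=
  ∃ σ : Var Sg → STerm Sg, IsSorted σ ∧ ∀ d ∈ Ψ, ¬ EqE E (d.1.bind σ) (d.2.bind σ)

def SStrand.map (μ : Var Sg → STerm Sg) (st : SStrand Sg Role) : SStrand Sg Role :=
  ⟨st.role, st.fresh, st.past.map (SMsg.map (Term.bind μ)),
    st.future.map (SMsg.map (Term.bind μ))⟩

/-- The instance of a state under `μ`, `SS ↦ X & SS`, `IK ↦ Y, IK`. -/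
def CState.subst (μ : Var Sg → STerm Sg) (X : Multiset (SStrand Sg Role))
    (Y : Multiset (IFact (STerm Sg))) (C : CState Sg Role) : CState Sg Role :=
  ⟨C.strands.map (SStrand.map μ) + X, C.facts.map (IFact.map (Term.bind μ)) + Y,
    C.store.map (fun d => (d.1.bind μ, d.2.bind μ))⟩

/-- Equality of strands and of states modulo `E`. -/
structure SStrand.EqMod (E : Set (STerm Sg × STerm Sg)) (a b : SStrand Sg Role) : Prop where
  role : a.role = b.role
  fresh : a.fresh = b.fresh
  past : List.Forall₂ (SMsg.Rel (EqE E)) a.past b.past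
  future : List.Forall₂ (SMsg.Rel (EqE E)) a.future b.future

structure CState.EqMod (E : Set (STerm Sg × STerm Sg)) (C D : CState Sg Role) : Prop where
  strands : Multiset.Rel (SStrand.EqMod E) C.strands D.strands
  facts : Multiset.Rel (IFact.Rel (EqE E)) C.facts D.facts
  store : Multiset.Rel (fun d e => EqE E d.1 e.1 ∧ EqE E d.2 e.2) C.store D.store

/-- The instances of the rules of the constrained backwards semantics, in forward orientation.
`BRule P D K D'` says that `D → D'` is one, in which the intruder learns the messages `K`. -/
inductive BRule (P : Protocol Sg Role) :
    CState Sg Role → Multiset (STerm Sg) → CState Sg Role → Prop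
  /-- (B-) -/
  | recv (SS : Multiset (SStrand Sg Role)) (IK : Multiset (IFact (STerm Sg)))
      (Ψ : Multiset (STerm Sg × STerm Sg)) (ro : Role) (fr : Finset ℕ)
      (L L' : List (SMsg (STerm Sg))) (M : STerm Sg) :
      BRule P ⟨⟨ro, fr, L, .inp M :: L'⟩ ::ₘ SS, .pos M ::ₘ IK, Ψ⟩ 0
        ⟨⟨ro, fr, L ++ [.inp M], L'⟩ ::ₘ SS, .pos M ::ₘ IK, Ψ⟩
  /-- (B+) -/
  | send (SS : Multiset (SStrand Sg Role)) (IK : Multiset (IFact (STerm Sg)))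
      (Ψ : Multiset (STerm Sg × STerm Sg)) (ro : Role) (fr : Finset ℕ)
      (L L' : List (SMsg (STerm Sg))) (M : STerm Sg) :
      BRule P ⟨⟨ro, fr, L, .out M :: L'⟩ ::ₘ SS, IK, Ψ⟩ 0
        ⟨⟨ro, fr, L ++ [.out M], L'⟩ ::ₘ SS, IK, Ψ⟩
  /-- (B++) -/
  | sendLearn (SS : Multiset (SStrand Sg Role)) (IK : Multiset (IFact (STerm Sg)))
      (Ψ : Multiset (STerm Sg × STerm Sg)) (ro : Role) (fr : Finset ℕ)
      (L L' : List (SMsg (STerm Sg))) (M : STerm Sg) :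
      BRule P ⟨⟨ro, fr, L, .out M :: L'⟩ ::ₘ SS, .neg M ::ₘ IK, Ψ⟩ {M}
        ⟨⟨ro, fr, L ++ [.out M], L'⟩ ::ₘ SS, .pos M ::ₘ IK, Ψ⟩
  /-- (B&), for a renamed and instantiated protocol strand `[l₁, u⁺, l₂]` -/
  | newStrand (SS : Multiset (SStrand Sg Role)) (IK : Multiset (IFact (STerm Sg)))
      (Ψ : Multiset (STerm Sg × STerm Sg)) (ro : Role) (fr : Finset ℕ)
      (l₁ l₂ : List (SMsg (STerm Sg))) (u' : STerm Sg) (ρ : Var Sg → STerm Sg)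
      (hP : (ro, l₁ ++ .out u' :: l₂) ∈ P.strands) (hρ : IsSorted ρ)
      (hfr : FreshRenaming (l₁ ++ .out u' :: l₂) ρ fr) :
      BRule P
        ⟨⟨ro, fr, l₁.map (SMsg.map (Term.bind ρ)),
            .out (u'.bind ρ) :: l₂.map (SMsg.map (Term.bind ρ))⟩ ::ₘ SS,
          .neg (u'.bind ρ) ::ₘ IK, Ψ⟩
        {u'.bind ρ}
        ⟨SS, .pos (u'.bind ρ) ::ₘ IK, Ψ⟩
  /-- (B?) -/
  | choice (SS : Multiset (SStrand Sg Role)) (IK : Multiset (IFact (STerm Sg)))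
      (Ψ : Multiset (STerm Sg × STerm Sg)) (ro : Role) (fr : Finset ℕ)
      (L L' : List (SMsg (STerm Sg))) (num : ℕ) :
      BRule P ⟨⟨ro, fr, L, .cstr .nondet num :: L'⟩ ::ₘ SS, IK, Ψ⟩ 0
        ⟨⟨ro, fr, L ++ [.cstr .nondet num], L'⟩ ::ₘ SS, IK, Ψ⟩
  /-- (Bif=) -/
  | ifEq (SS : Multiset (SStrand Sg Role)) (IK : Multiset (IFact (STerm Sg)))
      (Ψ : Multiset (STerm Sg × STerm Sg)) (ro : Role) (fr : Finset ℕ)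
      (L L' : List (SMsg (STerm Sg))) (M : STerm Sg) (num : ℕ) :
      BRule P ⟨⟨ro, fr, L, .cstr (.eq M M) num :: L'⟩ ::ₘ SS, IK, Ψ⟩ 0
        ⟨⟨ro, fr, L ++ [.cstr (.eq M M) num], L'⟩ ::ₘ SS, IK, Ψ⟩
  /-- (Bif≠) -/
  | ifNe (SS : Multiset (SStrand Sg Role)) (IK : Multiset (IFact (STerm Sg)))
      (Ψ : Multiset (STerm Sg × STerm Sg)) (ro : Role) (fr : Finset ℕ)
      (L L' : List (SMsg (STerm Sg))) (M M' : STerm Sg) (num : ℕ)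
      (hsat : Satisfiable P.eqs ((M, M') ::ₘ Ψ)) :
      BRule P ⟨⟨ro, fr, L, .cstr (.ne M M') num :: L'⟩ ::ₘ SS, IK, (M, M') ::ₘ Ψ⟩ 0
        ⟨⟨ro, fr, L ++ [.cstr (.ne M M') num], L'⟩ ::ₘ SS, IK, Ψ⟩

/-- One backwards narrowing step `C ↜_μ C'`, learning `K`: an instance of `C'` under a unifier
equals, modulo `E` and the axioms of multisets and lists, the right-hand side of a rule instance
whose left-hand side is the symbolic state `C`. The unifier never instantiates fresh variables;
that `C` is symbolic forces the fresh variables of a strand added by (B&) to be new.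
Any unifier is allowed, in particular those in any complete set of unifiers. -/
def Narrow (P : Protocol Sg Role) (C' : CState Sg Role) (μ : Var Sg → STerm Sg)
    (K : Multiset (STerm Sg)) (C : CState Sg Role) : Prop :=
  IsSorted μ ∧ (∀ n, μ (Var.ofFresh Sg n) = .leaf (Var.ofFresh Sg n)) ∧
  ∃ (X : Multiset (SStrand Sg Role)) (Y : Multiset (IFact (STerm Sg))) (D' : CState Sg Role),
    (C'.subst μ X Y).EqMod P.eqs D' ∧ BRule P C K D' ∧ C.IsSymbolic P

/-- Backwards narrowing `C₀ ↜*_μ C'` in any number of steps, with the composed substitution `μ`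
and all the messages `K` that the intruder learns on the way from `C₀` to `C'`,
both in terms of the variables of `C₀`. -/
inductive NarrowStar (P : Protocol Sg Role) :
    CState Sg Role → (Var Sg → STerm Sg) → Multiset (STerm Sg) → CState Sg Role → Prop
  | refl (C : CState Sg Role) : NarrowStar P C Term.leaf 0 C
  | step {C' C₁ C₀ : CState Sg Role} {μ ν : Var Sg → STerm Sg} {K₁ K₂ : Multiset (STerm Sg)} :
      Narrow P C' μ K₁ C₁ → NarrowStar P C₁ ν K₂ C₀ →
      NarrowStar P C' (fun x => (μ x).bind ν) (K₁.map (Term.bind ν) + K₂) C₀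

end Symbolic

section Ground

variable {Sg : Signature.{u, v}} {Role : Type r}

/-- Ground strand states of `P`: every strand is, modulo `E`, a ground instance of an initial
segment of a strand of the protocol. -/
structure GState.IsGround (P : Protocol Sg Role) (s : GState Sg Role) : Prop where
  inst : ∀ g ∈ s.strands, ∃ (l l' : List (SMsg (STerm Sg))) (τ : Var Sg → GTerm Sg Role),
    (g.role, l ++ l') ∈ P.strands ∧ IsSorted τ ∧
    List.Forall₂ (SMsg.Rel (EqE P.eqs)) (l.map (SMsg.map (Term.bind τ))) g.msgs
  ik_msg : ∀ m ∈ s.ik, HasSort m Sg.msg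

/-- Initial ground states: nothing has been executed and nothing is known. -/
def GState.IsInitial (s : GState Sg Role) : Prop :=
  (∀ g ∈ s.strands, g.msgs = []) ∧ s.ik = 0

open Classical in
/-- The largest identifier of a strand of role `ro`, and 0 if there is none. -/
noncomputable def maxStrId (SS : Multiset (GStrand Sg Role)) (ro : Role) : ℕ :=
  ((SS.filter fun g => g.role = ro).map fun g => g.id).sup

/-- `τ` is a sorted ground substitution that extends `ρ_{ro,i} = {r ↦ r.ro.i}`. -/
def SessionSubst (ro : Role) (i : ℕ) (τ : Var Sg → GTerm Sg Role) : Prop :=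
  IsSorted τ ∧ ∀ n, τ (Var.ofFresh Sg n) = .leaf ⟨n, ro, i⟩

/-- `x` is an element that a strand `(ro, i)[v]` can be extended by: the protocol has a strand
`[pre, u, post]` of role `ro`, and `v` and `x` are instances of `pre` (modulo `E`) and `u`. The
substitution comprises the match, the fresh substitution, and the values of the choice variables. -/
def Extends (P : Protocol Sg Role) (ro : Role) (i : ℕ) (v : List (SMsg (GTerm Sg Role)))
    (x : SMsg (GTerm Sg Role)) : Prop :=
  ∃ (pre post : List (SMsg (STerm Sg))) (y : SMsg (STerm Sg)) (τ : Var Sg → GTerm Sg Role),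
    (ro, pre ++ y :: post) ∈ P.strands ∧ SessionSubst ro i τ ∧
    List.Forall₂ (SMsg.Rel (EqE P.eqs)) v (pre.map (SMsg.map (Term.bind τ))) ∧
    x = y.map (Term.bind τ)

/-- `m` is known to the intruder, modulo `E`. -/
def Known (P : Protocol Sg Role) (IK : Multiset (GTerm Sg Role)) (m : GTerm Sg Role) : Prop :=
  ∃ m' ∈ IK, EqE P.eqs m' m

/-- Truth of a ground constraint modulo `E`. -/
def Cstr.Holds (P : Protocol Sg Role) : Cstr (GTerm Sg Role) → Prop
  | .nondet => True
  | .eq a b => EqE P.eqs a b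
  | .ne a b => ¬ EqE P.eqs a b

/-- The transitions of the constrained forwards strand semantics. -/
inductive FStep (P : Protocol Sg Role) : GState Sg Role → GState Sg Role → Prop
  /-- (F++) -/
  | sendLearn (SS : Multiset (GStrand Sg Role)) (IK : Multiset (GTerm Sg Role)) (ro : Role) (i : ℕ)
      (v : List (SMsg (GTerm Sg Role))) (m : GTerm Sg Role) :
      v ≠ [] → Extends P ro i v (.out m) → ¬ Known P IK m →
      FStep P ⟨⟨ro, i, v⟩ ::ₘ SS, IK⟩ ⟨⟨ro, i, v ++ [.out m]⟩ ::ₘ SS, m ::ₘ IK⟩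
  /-- (F+) -/
  | send (SS : Multiset (GStrand Sg Role)) (IK : Multiset (GTerm Sg Role)) (ro : Role) (i : ℕ)
      (v : List (SMsg (GTerm Sg Role))) (m : GTerm Sg Role) :
      v ≠ [] → Extends P ro i v (.out m) →
      FStep P ⟨⟨ro, i, v⟩ ::ₘ SS, IK⟩ ⟨⟨ro, i, v ++ [.out m]⟩ ::ₘ SS, IK⟩
  /-- (F++&) -/
  | newSendLearn (SS : Multiset (GStrand Sg Role)) (IK : Multiset (GTerm Sg Role)) (ro : Role)
      (m : GTerm Sg Role) :
      Extends P ro (maxStrId SS ro + 1) [] (.out m) → ¬ Known P IK m →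
      FStep P ⟨SS, IK⟩ ⟨⟨ro, maxStrId SS ro + 1, [.out m]⟩ ::ₘ SS, m ::ₘ IK⟩
  /-- (F+&) -/
  | newSend (SS : Multiset (GStrand Sg Role)) (IK : Multiset (GTerm Sg Role)) (ro : Role)
      (m : GTerm Sg Role) :
      Extends P ro (maxStrId SS ro + 1) [] (.out m) →
      FStep P ⟨SS, IK⟩ ⟨⟨ro, maxStrId SS ro + 1, [.out m]⟩ ::ₘ SS, IK⟩
  /-- (F-) -/
  | recv (SS : Multiset (GStrand Sg Role)) (IK : Multiset (GTerm Sg Role)) (ro : Role) (i : ℕ)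
      (v : List (SMsg (GTerm Sg Role))) (m : GTerm Sg Role) :
      v ≠ [] → Extends P ro i v (.inp m) → Known P IK m →
      FStep P ⟨⟨ro, i, v⟩ ::ₘ SS, IK⟩ ⟨⟨ro, i, v ++ [.inp m]⟩ ::ₘ SS, IK⟩
  /-- (F-&) -/
  | newRecv (SS : Multiset (GStrand Sg Role)) (IK : Multiset (GTerm Sg Role)) (ro : Role)
      (m : GTerm Sg Role) :
      Extends P ro (maxStrId SS ro + 1) [] (.inp m) → Known P IK m →
      FStep P ⟨SS, IK⟩ ⟨⟨ro, maxStrId SS ro + 1, [.inp m]⟩ ::ₘ SS, IK⟩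
  /-- (Fif) -/
  | ifC (SS : Multiset (GStrand Sg Role)) (IK : Multiset (GTerm Sg Role)) (ro : Role) (i : ℕ)
      (v : List (SMsg (GTerm Sg Role))) (c : Cstr (GTerm Sg Role)) (num : ℕ) :
      v ≠ [] → Extends P ro i v (.cstr c num) → c ≠ .nondet → c.Holds P →
      FStep P ⟨⟨ro, i, v⟩ ::ₘ SS, IK⟩ ⟨⟨ro, i, v ++ [.cstr c num]⟩ ::ₘ SS, IK⟩
  /-- (F?) -/
  | choice (SS : Multiset (GStrand Sg Role)) (IK : Multiset (GTerm Sg Role)) (ro : Role) (i : ℕ)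
      (v : List (SMsg (GTerm Sg Role))) (num : ℕ) :
      v ≠ [] → Extends P ro i v (.cstr .nondet num) →
      FStep P ⟨⟨ro, i, v⟩ ::ₘ SS, IK⟩ ⟨⟨ro, i, v ++ [.cstr .nondet num]⟩ ::ₘ SS, IK⟩
  /-- (F?&) -/
  | newChoice (SS : Multiset (GStrand Sg Role)) (IK : Multiset (GTerm Sg Role)) (ro : Role)
      (num : ℕ) :
      Extends P ro (maxStrId SS ro + 1) [] (.cstr .nondet num) →
      FStep P ⟨SS, IK⟩ ⟨⟨ro, maxStrId SS ro + 1, [.cstr .nondet num]⟩ ::ₘ SS, IK⟩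

/-- `Lifts P C θ s`, written `C >^θ s`: the constrained symbolic state `C` instantiates to the
ground state `s` with `θ`. A strand whose bar is at the beginning has not been executed and asks
for nothing in `s`. -/
structure Lifts (P : Protocol Sg Role) (C : CState Sg Role) (θ : Var Sg → GTerm Sg Role)
    (s : GState Sg Role) : Prop where
  sorted : IsSorted θ
  strands : ∀ st ∈ C.strands, st.past ≠ [] → ∃ g ∈ s.strands, g.role = st.role ∧
    List.Forall₂ (SMsg.Rel (EqE P.eqs)) g.msgs (st.past.map (SMsg.map (Term.bind θ)))
  pos : ∀ m, IFact.pos m ∈ C.facts → Known P s.ik (m.bind θ)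
  neg : ∀ m, IFact.neg m ∈ C.facts → ¬ Known P s.ik (m.bind θ)
  store : ∀ d ∈ C.store, ¬ EqE P.eqs (d.1.bind θ) (d.2.bind θ)

end Ground

/-! ### Terms: substitution, sorts and equality modulo `E` -/

section TermLemmas

variable {Sg : Signature.{u, v}}

/-! Read forwards from `C₀`, every narrowing step executes one element of one strand, and all these
strands, including those that (B&) introduces backwards, already stand unexecuted in `C₀`. Each of
them becomes a session, whose variables are instantiated by terms in the variables of `C₀`, and the
forward rules are replayed on these sessions (`Simulates.rule`).

The obstacle is that `θ` cannot be used for the replay. The forwards semantics forces a fresh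
variable `r` of a session to be `r.ro.i`, where `i` is fixed only when the session starts, whereas
`θ` may give fresh variables any values and may even identify them. So the invariant `Reach`
collects the forced names in a partial injective map `N` and claims an execution for every sorted
`θ'` that respects `N` and identifies no more terms than `θ`. This is enough for all conditions of
the rules: received messages and equality tests match modulo `E` before grounding, hence under any
`θ'`, and disequalities, which hold under `θ`, hold under any `θ'` that separates as much. Session
identifiers do not depend on `θ'`, so `N` can be chosen uniformly.

At the end `exists_respects_separates` provides such a `θ'`: fresh variables in the domain of `N`
get their names, and all names in the other values of `θ` are shifted to unused identifiers. Some
substitution of names turns `θ'` back into `θ`, which gives the separation.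

Negative facts are not tracked. When a message to be learned happens to be known already, the ground
execution sends it without learning. Only the bound is kept that each known message is an instance
of a learned one. With the hypothesis on learned messages, this yields the negative facts of `C'`.
-/

theorem Term.bind_bind {V W X : Type*} (σ : V → Term Sg W) (τ : W → Term Sg X) (t : Term Sg V) :
    (t.bind σ).bind τ = t.bind (fun x => (σ x).bind τ) := by
  induction t with
  | leaf x => rfl
  | app f args ih => simp only [Term.bind, ih]

theorem Term.bind_leaf {V : Type*} (t : Term Sg V) : t.bind Term.leaf = t := by
  induction t with
  | leaf x => rfl
  | app f args ih => simp only [Term.bind, ih]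

theorem Term.bind_congr {V W : Type*} {σ τ : V → Term Sg W} (t : Term Sg V)
    (h : ∀ x ∈ t.leaves, σ x = τ x) : t.bind σ = t.bind τ := by
  induction t with
  | leaf x => exact h x rfl
  | app f args ih =>
    simp only [Term.bind]
    congr 1
    funext i
    exact ih i fun x hx => h x (Set.mem_iUnion.2 ⟨i, hx⟩)

theorem HasSort.mono {V : Type*} [SortedLeaves Sg V] {t : Term Sg V} {s s' : Sg.Srt}
    (h : HasSort t s) (hs : s ≤ s') : HasSort t s' := by
  cases h with
  | leaf x _ hx => exact .leaf x _ (hx.trans hs)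
  | app f args a s₁ _ hr ha hs₁ => exact .app f args a s₁ _ hr ha (hs₁.trans hs)

theorem HasSort.bind {V W : Type*} [SortedLeaves Sg V] [SortedLeaves Sg W] {t : Term Sg V}
    {s : Sg.Srt} {σ : V → Term Sg W} (h : HasSort t s) (hσ : IsSorted σ) :
    HasSort (t.bind σ) s := by
  induction h with
  | leaf x s hx => exact (hσ x).mono hx
  | app f args a s s' hr _ hs ih => exact .app f _ a s s' hr ih hs

theorem IsSorted.bind {V W X : Type*} [SortedLeaves Sg V] [SortedLeaves Sg W] [SortedLeaves Sg X]
    {σ : V → Term Sg W} {τ : W → Term Sg X} (hσ : IsSorted σ) (hτ : IsSorted τ) :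
    IsSorted (fun x => (σ x).bind τ) := fun x => (hσ x).bind hτ

theorem IsSorted.leaf {V : Type*} [SortedLeaves Sg V] :
    IsSorted (Term.leaf : V → Term Sg V) := fun x => .leaf x _ le_rfl

/-- The instances of an equation are closed under sorted substitution. The leaves are arbitrary, so
this also covers the replacement of names in ground terms, on which the final choice of `θ'` rests.
-/
theorem EqE.bind {E : Set (STerm Sg × STerm Sg)} {V W : Type*} [SortedLeaves Sg V]
    [SortedLeaves Sg W] {t t' : Term Sg V} {σ : V → Term Sg W} (h : EqE E t t')
    (hσ : IsSorted σ) : EqE E (t.bind σ) (t'.bind σ) := by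
  induction h with
  | refl t => exact .refl _
  | symm _ ih => exact ih.symm
  | trans _ _ ih ih' => exact ih.trans ih'
  | inst l r' τ hE hτ =>
    rw [Term.bind_bind, Term.bind_bind]
    exact .inst l r' _ hE (hτ.bind hσ)
  | congr f args args' a s hr h h' _ ih =>
    exact .congr f _ _ a s hr (fun i => (h i).bind hσ) (fun i => (h' i).bind hσ) ih

end TermLemmas

/-! ### Strand elements and lists of them: maps and relations -/

section LiftLemmas

variable {T T' T'' : Type*}

theorem SMsg.map_map (f : T → T') (g : T' → T'') (x : SMsg T) :
    (x.map f).map g = x.map (fun t => g (f t)) := by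
  rcases x with m | m | ⟨_ | ⟨a, b⟩ | ⟨a, b⟩, n⟩ <;> rfl

theorem SMsg.map_id (x : SMsg T) : x.map (fun t => t) = x := by
  rcases x with m | m | ⟨_ | ⟨a, b⟩ | ⟨a, b⟩, n⟩ <;> rfl

theorem SMsg.map_congr {f g : T → T'} (x : SMsg T) (h : ∀ t ∈ x.terms, f t = g t) :
    x.map f = x.map g := by
  rcases x with m | m | ⟨_ | ⟨a, b⟩ | ⟨a, b⟩, n⟩ <;> simp_all [SMsg.terms, SMsg.map, Cstr.map]

variable {R : T → T → Prop}

theorem SMsg.Rel.refl (hR : ∀ a, R a a) (x : SMsg T) : SMsg.Rel R x x := by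
  rcases x with m | m | ⟨_ | ⟨a, b⟩ | ⟨a, b⟩, n⟩
  · exact .out (hR _)
  · exact .inp (hR _)
  · exact .cstr _ .nondet
  · exact .cstr _ (.eq (hR _) (hR _))
  · exact .cstr _ (.ne (hR _) (hR _))

theorem SMsg.Rel.symm (hR : ∀ a b, R a b → R b a) {x y : SMsg T} (h : SMsg.Rel R x y) :
    SMsg.Rel R y x := by
  rcases h with h | h | ⟨n, _ | ⟨h, h'⟩ | ⟨h, h'⟩⟩
  · exact .out (hR _ _ h)
  · exact .inp (hR _ _ h)
  · exact .cstr _ .nondet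
  · exact .cstr _ (.eq (hR _ _ h) (hR _ _ h'))
  · exact .cstr _ (.ne (hR _ _ h) (hR _ _ h'))

theorem SMsg.Rel.trans (hR : ∀ a b c, R a b → R b c → R a c) {x y z : SMsg T}
    (h : SMsg.Rel R x y) (h' : SMsg.Rel R y z) : SMsg.Rel R x z := by
  rcases h with h | h | ⟨n, _ | ⟨h₁, h₂⟩ | ⟨h₁, h₂⟩⟩
  · rcases h' with h' | _ | _
    exact .out (hR _ _ _ h h')
  · rcases h' with _ | h' | _
    exact .inp (hR _ _ _ h h')
  · exact h'
  · rcases h' with _ | _ | ⟨n, _ | ⟨h₃, h₄⟩ | _⟩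
    exact .cstr _ (.eq (hR _ _ _ h₁ h₃) (hR _ _ _ h₂ h₄))
  · rcases h' with _ | _ | ⟨n, _ | _ | ⟨h₃, h₄⟩⟩
    exact .cstr _ (.ne (hR _ _ _ h₁ h₃) (hR _ _ _ h₂ h₄))

theorem SMsg.Rel.map {R' : T' → T' → Prop} {f : T → T'} (hf : ∀ a b, R a b → R' (f a) (f b))
    {x y : SMsg T} (h : SMsg.Rel R x y) : SMsg.Rel R' (x.map f) (y.map f) := by
  rcases h with h | h | ⟨n, _ | ⟨h₁, h₂⟩ | ⟨h₁, h₂⟩⟩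
  · exact .out (hf _ _ h)
  · exact .inp (hf _ _ h)
  · exact .cstr _ .nondet
  · exact .cstr _ (.eq (hf _ _ h₁) (hf _ _ h₂))
  · exact .cstr _ (.ne (hf _ _ h₁) (hf _ _ h₂))

end LiftLemmas

theorem SMsg.map_bind_bind {Sg : Signature.{u, v}} {V W X : Type*} (σ : V → Term Sg W)
    (τ : W → Term Sg X) (x : SMsg (Term Sg V)) :
    (x.map (Term.bind σ)).map (Term.bind τ) = x.map (Term.bind fun y => (σ y).bind τ) := by
  rw [SMsg.map_map]
  exact SMsg.map_congr x fun t _ => Term.bind_bind σ τ t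

section BindMsgs

variable {Sg : Signature.{u, v}}

/-- Application of a substitution to a list of strand elements. -/
abbrev bindMsgs {V W : Type*} (σ : V → Term Sg W) (l : List (SMsg (Term Sg V))) :
    List (SMsg (Term Sg W)) :=
  l.map (SMsg.map (Term.bind σ))

theorem bindMsgs_bindMsgs {V W X : Type*} (σ : V → Term Sg W) (τ : W → Term Sg X)
    (l : List (SMsg (Term Sg V))) :
    bindMsgs τ (bindMsgs σ l) = bindMsgs (fun x => (σ x).bind τ) l := by
  simp only [bindMsgs, List.map_map]
  exact List.map_congr_left fun x _ => SMsg.map_bind_bind σ τ x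

theorem bindMsgs_leaf {V : Type*} (l : List (SMsg (Term Sg V))) : bindMsgs Term.leaf l = l := by
  conv_rhs => rw [← List.map_id l]
  refine List.map_congr_left fun x _ => ?_
  conv_rhs => rw [id, ← SMsg.map_id x]
  exact SMsg.map_congr x fun t _ => Term.bind_leaf t

end BindMsgs

section MsgsEq

variable {Sg : Signature.{u, v}} (E : Set (STerm Sg × STerm Sg)) {V W : Type*} [SortedLeaves Sg V]
  [SortedLeaves Sg W]

/-- Equality of lists of strand elements modulo `E`. -/
abbrev MsgsEq (l l' : List (SMsg (Term Sg V))) : Prop := List.Forall₂ (SMsg.Rel (EqE E)) l l'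

variable {E}

theorem SMsg.Rel.eqE_trans {x y z : SMsg (Term Sg V)} (h : SMsg.Rel (EqE E) x y)
    (h' : SMsg.Rel (EqE E) y z) : SMsg.Rel (EqE E) x z :=
  SMsg.Rel.trans (fun _ _ _ => EqE.trans) h h'

theorem MsgsEq.refl (l : List (SMsg (Term Sg V))) : MsgsEq E l l :=
  List.forall₂_same.2 fun x _ => SMsg.Rel.refl EqE.refl x

theorem MsgsEq.symm {l l' : List (SMsg (Term Sg V))} (h : MsgsEq E l l') : MsgsEq E l' l := by
  induction h with
  | nil => exact .nil
  | cons h _ ih => exact .cons (h.symm fun _ _ => EqE.symm) ih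

theorem MsgsEq.trans {l l' l'' : List (SMsg (Term Sg V))} (h : MsgsEq E l l')
    (h' : MsgsEq E l' l'') : MsgsEq E l l'' := by
  induction h generalizing l'' with
  | nil => exact h'
  | cons h _ ih =>
    cases h' with
    | cons h₁ h₂ => exact .cons (h.eqE_trans h₁) (ih h₂)

theorem MsgsEq.bind {l l' : List (SMsg (Term Sg V))} (h : MsgsEq E l l') {σ : V → Term Sg W}
    (hσ : IsSorted σ) : MsgsEq E (bindMsgs σ l) (bindMsgs σ l') := by
  induction h with
  | nil => exact .nil
  | cons h _ ih => exact .cons (h.map fun _ _ he => he.bind hσ) ih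

end MsgsEq

/-! ### Forward steps on ground states -/

section GroundLemmas

variable {Sg : Signature.{u, v}} {Role : Type r} {P : Protocol Sg Role}

theorem Known.of_eqE {IK : Multiset (GTerm Sg Role)} {m m' : GTerm Sg Role} (h : Known P IK m)
    (e : EqE P.eqs m m') : Known P IK m' :=
  let ⟨x, hx, hxm⟩ := h
  ⟨x, hx, hxm.trans e⟩

theorem Known.mono {IK IK' : Multiset (GTerm Sg Role)} {m : GTerm Sg Role} (h : Known P IK m)
    (hle : IK ≤ IK') : Known P IK' m :=
  let ⟨x, hx, hxm⟩ := h
  ⟨x, Multiset.mem_of_le hle hx, hxm⟩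

theorem maxStrId_cons (SS : Multiset (GStrand Sg Role)) (g : GStrand Sg Role) (ro : Role)
    [Decidable (g.role = ro)] :
    maxStrId (g ::ₘ SS) ro = if g.role = ro then g.id ⊔ maxStrId SS ro else maxStrId SS ro := by
  classical
  unfold maxStrId
  split_ifs with h
  · rw [Multiset.filter_cons_of_pos (p := fun g => g.role = ro) (a := g) _ h, Multiset.map_cons,
      Multiset.sup_cons]
  · rw [Multiset.filter_cons_of_neg (p := fun g => g.role = ro) (a := g) _ h]

theorem Extends.isInstance {ro : Role} {i : ℕ} {v : List (SMsg (GTerm Sg Role))}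
    {x : SMsg (GTerm Sg Role)} (h : Extends P ro i v x) :
    ∃ (l l' : List (SMsg (STerm Sg))) (τ : Var Sg → GTerm Sg Role),
      (ro, l ++ l') ∈ P.strands ∧ IsSorted τ ∧ MsgsEq P.eqs (bindMsgs τ l) (v ++ [x]) := by
  obtain ⟨pre, post, y, τ, hP, hτ, hv, rfl⟩ := h
  refine ⟨pre ++ [y], post, τ, by simpa using hP, hτ.1, ?_⟩
  rw [bindMsgs, List.map_append]
  exact List.rel_append (MsgsEq.symm hv) (MsgsEq.refl _)

theorem Extends.hasSort {ro : Role} {i : ℕ} {v : List (SMsg (GTerm Sg Role))} {m : GTerm Sg Role}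
    (h : Extends P ro i v (.out m)) : HasSort m Sg.msg := by
  obtain ⟨pre, post, y, τ, hP, hτ, hv, hy⟩ := h
  cases y with
  | out u =>
    obtain rfl : m = u.bind τ := by simpa [SMsg.map] using hy
    exact (P.strands_msg _ hP (.out u) (by simp) u rfl).bind hτ.1
  | inp u => cases hy
  | cstr c n => cases hy

theorem GState.IsGround.of_extends {SS SS' : Multiset (GStrand Sg Role)}
    {IK IK' : Multiset (GTerm Sg Role)} (h : GState.IsGround P ⟨SS', IK⟩) (hle : SS ≤ SS')
    {ro : Role} {i : ℕ} {v : List (SMsg (GTerm Sg Role))} {x : SMsg (GTerm Sg Role)}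
    (hx : Extends P ro i v x) (hik : ∀ m ∈ IK', m ∈ IK ∨ HasSort m Sg.msg) :
    GState.IsGround P ⟨⟨ro, i, v ++ [x]⟩ ::ₘ SS, IK'⟩ where
  inst g hg := by
    rcases Multiset.mem_cons.1 hg with rfl | hg
    · exact hx.isInstance
    · exact h.inst g (Multiset.mem_of_le hle hg)
  ik_msg m hm := (hik m hm).elim (h.ik_msg m) id

theorem FStep.isGround {s s' : GState Sg Role} (h : FStep P s s') (hs : s.IsGround P) :
    s'.IsGround P := by
  have hcons : ∀ (g : GStrand Sg Role) (SS : Multiset (GStrand Sg Role)), SS ≤ g ::ₘ SS :=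
    fun g SS => Multiset.le_cons_self SS g
  have hlearn : ∀ (IK : Multiset (GTerm Sg Role)) (m : GTerm Sg Role), HasSort m Sg.msg →
      ∀ z ∈ m ::ₘ IK, z ∈ IK ∨ HasSort z Sg.msg := fun IK m hm z hz =>
    (Multiset.mem_cons.1 hz).symm.imp id fun e => by rwa [e]
  cases h with
  | sendLearn SS IK ro i v m hv hx hk => exact hs.of_extends (hcons _ _) hx (hlearn _ _ hx.hasSort)
  | newSendLearn SS IK ro m hx hk => exact hs.of_extends le_rfl hx (hlearn _ _ hx.hasSort)
  | send SS IK ro i v m hv hx => exact hs.of_extends (hcons _ _) hx fun _ => Or.inl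
  | recv SS IK ro i v m hv hx hk => exact hs.of_extends (hcons _ _) hx fun _ => Or.inl
  | ifC SS IK ro i v c num hv hx hc hh => exact hs.of_extends (hcons _ _) hx fun _ => Or.inl
  | choice SS IK ro i v num hv hx => exact hs.of_extends (hcons _ _) hx fun _ => Or.inl
  | newSend SS IK ro m hx => exact hs.of_extends le_rfl hx fun _ => Or.inl
  | newRecv SS IK ro m hx hk => exact hs.of_extends le_rfl hx fun _ => Or.inl
  | newChoice SS IK ro num hx => exact hs.of_extends le_rfl hx fun _ => Or.inl

/-- The condition under which an element may be executed at the end of the ground strand `v`. -/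
def Enabled (P : Protocol Sg Role) (IK : Multiset (GTerm Sg Role))
    (v : List (SMsg (GTerm Sg Role))) : SMsg (GTerm Sg Role) → Prop
  | .out _ => True
  | .inp m => Known P IK m
  -- No forward rule starts a strand with an equality or disequality test.
  | .cstr c _ => c.Holds P ∧ (v = [] → c = .nondet)

/-- An enabled element extends a strand that has been started, and nothing is learned. -/
theorem FStep.of_enabled {SS : Multiset (GStrand Sg Role)} {IK : Multiset (GTerm Sg Role)}
    {ro : Role} {i : ℕ} {v : List (SMsg (GTerm Sg Role))} {x : SMsg (GTerm Sg Role)}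
    (hv : v ≠ []) (hx : Extends P ro i v x) (he : Enabled P IK v x) :
    FStep P ⟨⟨ro, i, v⟩ ::ₘ SS, IK⟩ ⟨⟨ro, i, v ++ [x]⟩ ::ₘ SS, IK⟩ := by
  rcases x with m | m | ⟨c, n⟩
  · exact .send SS IK ro i v m hv hx
  · exact .recv SS IK ro i v m hv hx he
  · by_cases hc : c = .nondet
    · subst hc
      exact .choice SS IK ro i v n hv hx
    · exact .ifC SS IK ro i v c n hv hx hc he.1

/-- An enabled element starts a strand, and nothing is learned. -/
theorem FStep.new_of_enabled {SS : Multiset (GStrand Sg Role)} {IK : Multiset (GTerm Sg Role)}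
    {ro : Role} {x : SMsg (GTerm Sg Role)} (hx : Extends P ro (maxStrId SS ro + 1) [] x)
    (he : Enabled P IK [] x) :
    FStep P ⟨SS, IK⟩ ⟨⟨ro, maxStrId SS ro + 1, [x]⟩ ::ₘ SS, IK⟩ := by
  rcases x with m | m | ⟨c, n⟩
  · exact .newSend SS IK ro m hx
  · exact .newRecv SS IK ro m hx he
  · obtain rfl := he.2 rfl
    exact .newChoice SS IK ro n hx

end GroundLemmas

/-! ### Sessions and the names of their fresh variables -/

/-- A session of the strand `[past, future]` of a protocol, executed up to the bar. The variables
of the strand are instantiated by `subst`, and its fresh variables take their values in the session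
`id` of the role once it has been started. -/
structure Session (Sg : Signature.{u, v}) (Role : Type r) where
  role : Role
  id : ℕ
  fresh : Finset ℕ
  subst : Var Sg → STerm Sg
  past : List (SMsg (STerm Sg))
  future : List (SMsg (STerm Sg))

section Simulation

variable {Sg : Signature.{u, v}} {Role : Type r} {P : Protocol Sg Role}

/-- The session executes a strand of the protocol. -/
structure Session.Valid (P : Protocol Sg Role) (T : Session Sg Role) : Prop where
  mem : (T.role, T.past ++ T.future) ∈ P.strands
  sorted : IsSorted T.subst
  fresh : FreshRenaming (T.past ++ T.future) T.subst T.fresh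

/-- The names given by `N` to the fresh variables of the session are those of its identifier. -/
def Session.Named (N : ℕ → Option (Name Role)) (T : Session Sg Role) : Prop :=
  ∀ n ∈ freshIdx (T.past ++ T.future), ∃ k,
    T.subst (Var.ofFresh Sg n) = .leaf (Var.ofFresh Sg k) ∧ N k = some ⟨n, T.role, T.id⟩

/-- The ground strand of a session. -/
def Session.ground (θ : Var Sg → GTerm Sg Role) (T : Session Sg Role) : GStrand Sg Role :=
  ⟨T.role, T.id, bindMsgs θ (bindMsgs T.subst T.past)⟩

/-- The substitution `θ` gives fresh variables the names `N`. -/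
def Respects (N : ℕ → Option (Name Role)) (θ : Var Sg → GTerm Sg Role) : Prop :=
  ∀ k a, N k = some a → θ (Var.ofFresh Sg k) = .leaf a

/-- `θ'` identifies no more terms than `θ`. -/
def Separates (P : Protocol Sg Role) (θ' θ : Var Sg → GTerm Sg Role) : Prop :=
  ∀ a b : STerm Sg, EqE P.eqs (a.bind θ') (b.bind θ') → EqE P.eqs (a.bind θ) (b.bind θ)

/-- Next element of a session. -/
theorem Session.extends {N : ℕ → Option (Name Role)} {θ : Var Sg → GTerm Sg Role}
    (hθ : IsSorted θ) (hN : Respects N θ) {T : Session Sg Role} (hT : T.Valid P)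
    (hTN : T.Named N) {y : SMsg (STerm Sg)} {l : List (SMsg (STerm Sg))} (hf : T.future = y :: l) :
    Extends P T.role T.id (T.ground θ).msgs
      ((y.map (Term.bind T.subst)).map (Term.bind θ)) := by
  classical
  -- All fresh variables must get the names of this session, even those outside the strand. On the
  -- strand `τ` agrees with `T.subst` followed by `θ`, because `θ` respects the names in `N`.
  let τ : Var Sg → GTerm Sg Role := fun x =>
    if x.sort = Sg.fresh then .leaf ⟨x.idx, T.role, T.id⟩ else (T.subst x).bind θ
  have hτ : ∀ x ∈ T.past ++ T.future,
      (x.map (Term.bind T.subst)).map (Term.bind θ) = x.map (Term.bind τ) := by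
    intro x hx
    rw [SMsg.map_bind_bind]
    refine SMsg.map_congr x fun t ht => Term.bind_congr t fun ⟨s, n⟩ hz => ?_
    by_cases hs : s = Sg.fresh
    · subst hs
      obtain ⟨k, hk, hkN⟩ := hTN n ⟨x, hx, t, ht, hz⟩
      simp only [τ, if_true]
      rw [show (⟨Sg.fresh, n⟩ : Var Sg) = Var.ofFresh Sg n from rfl, hk]
      exact hN k _ hkN
    · simp [τ, hs]
  refine ⟨T.past, l, y, τ, hf ▸ hT.mem, ⟨fun x => ?_, fun n => if_pos rfl⟩, ?_,
    hτ y (by simp [hf])⟩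
  · by_cases hs : x.sort = Sg.fresh
    · simp only [τ, if_pos hs]
      exact .leaf _ _ hs.ge
    · simp only [τ, if_neg hs]
      exact (hT.sorted x).bind hθ
  · have : (T.ground θ).msgs = bindMsgs τ T.past := by
      simp only [Session.ground, bindMsgs, List.map_map]
      exact List.map_congr_left fun x hx => hτ x (by simp [hx])
    rw [this]
    exact MsgsEq.refl _

/-! ### Executions that are uniform in the ground substitution -/

open Classical in
/-- The ground states reached by an execution, whatever the values of the variables. `W` are
sessions in progress, the messages `F` are known, the intruder has learned only messages in `K`,
`N` are the names of the fresh variables of the sessions that have been started, and `m` counts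
these sessions. Any substitution `θ'` that respects `N` and does not identify more than `θ` does
gives a ground execution. -/
structure Reach (P : Protocol Sg Role) (θ : Var Sg → GTerm Sg Role) (s₀ : GState Sg Role)
    (W : Multiset (Session Sg Role)) (F : Set (STerm Sg)) (K : Multiset (STerm Sg))
    (N : ℕ → Option (Name Role)) (m : Role → ℕ) : Prop where
  valid : ∀ T ∈ W, T.Valid P
  nodup : (W.bind fun T => T.fresh.val).Nodup
  named : ∀ T ∈ W, T.past ≠ [] → T.Named N
  unnamed : ∀ T ∈ W, T.past = [] → ∀ k ∈ T.fresh, N k = none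
  inj : ∀ k k' a, N k = some a → N k' = some a → k = k'
  id_le : ∀ k a, N k = some a → a.id ≤ m a.role
  run : ∀ θ' : Var Sg → GTerm Sg Role, IsSorted θ' → Respects N θ' → Separates P θ' θ →
    ∃ s : GState Sg Role, Relation.ReflTransGen (FStep P) s₀ s ∧
      (∀ ro, maxStrId s.strands ro = m ro) ∧
      (W.filter fun T => T.past ≠ []).map (Session.ground θ') ≤ s.strands ∧
      (∀ f ∈ F, Known P s.ik (f.bind θ')) ∧
      (∀ x ∈ s.ik, ∃ k ∈ K, EqE P.eqs x (k.bind θ'))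

variable {θ : Var Sg → GTerm Sg Role} {s₀ : GState Sg Role} {W W' : Multiset (Session Sg Role)}
  {F : Set (STerm Sg)} {K : Multiset (STerm Sg)} {N : ℕ → Option (Name Role)} {m : Role → ℕ}

/-- Sessions may be forgotten, as `run` asks only for a submultiset of the ground strands. This
handles the strands matched by the state variable `SS` and those that disappear forwards in (B&). -/
theorem Reach.of_le (h : Reach P θ s₀ W F K N m) (hle : W' ≤ W) : Reach P θ s₀ W' F K N m where
  valid T hT := h.valid T (Multiset.mem_of_le hle hT)
  nodup := by
    obtain ⟨U, rfl⟩ := Multiset.le_iff_exists_add.1 hle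
    refine Multiset.nodup_of_le ?_ h.nodup
    rw [Multiset.add_bind]
    exact Multiset.le_add_right _ _
  named T hT := h.named T (Multiset.mem_of_le hle hT)
  unnamed T hT := h.unnamed T (Multiset.mem_of_le hle hT)
  inj := h.inj
  id_le := h.id_le
  run θ' hθ' hN hsep := by
    obtain ⟨s, hs, hm, hW, hF⟩ := h.run θ' hθ' hN hsep
    exact ⟨s, hs, hm,
      (Multiset.map_le_map (Multiset.filter_le_filter _ hle)).trans hW, hF⟩

theorem Reach.start (hs₀ : s₀.IsInitial) (hvalid : ∀ T ∈ W, T.Valid P)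
    (hnodup : (W.bind fun T => T.fresh.val).Nodup) (hpast : ∀ T ∈ W, T.past = []) :
    Reach P θ s₀ W ∅ 0 (fun _ => none) (maxStrId s₀.strands) where
  valid := hvalid
  nodup := hnodup
  named T hT h := absurd (hpast T hT) h
  unnamed _ _ _ _ _ := rfl
  inj _ _ _ h := by cases h
  id_le _ _ h := by cases h
  run θ' _ _ _ := by
    refine ⟨s₀, .refl, fun _ => rfl, ?_, fun f hf => hf.elim, fun x hx => ?_⟩
    · rw [Multiset.filter_eq_nil.2 fun T hT h => h (hpast T hT)]
      exact Multiset.zero_le _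
    · rw [hs₀.2] at hx
      exact absurd hx (Multiset.notMem_zero x)

/-! ### Executing one element of a session -/

/-- The session after the execution of the element `y`. -/
def Session.advance (T : Session Sg Role) (id : ℕ) (y : SMsg (STerm Sg))
    (l : List (SMsg (STerm Sg))) : Session Sg Role :=
  ⟨T.role, id, T.fresh, T.subst, T.past ++ [y], l⟩

/-- The conditions for the execution of an element, in terms of variables: `w` are the messages
that may be learned. -/
inductive Ready (P : Protocol Sg Role) (θ : Var Sg → GTerm Sg Role) (F : Set (STerm Sg)) :
    SMsg (STerm Sg) → Multiset (STerm Sg) → Prop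
  | send (a : STerm Sg) : Ready P θ F (.out a) 0
  | learn (a b : STerm Sg) : EqE P.eqs a b → Ready P θ F (.out a) {b}
  | recv (a f : STerm Sg) : f ∈ F → EqE P.eqs f a → Ready P θ F (.inp a) 0
  | nondet (n : ℕ) : Ready P θ F (.cstr .nondet n) 0
  | eq (a b : STerm Sg) (n : ℕ) : EqE P.eqs a b → Ready P θ F (.cstr (.eq a b) n) 0
  | ne (a b : STerm Sg) (n : ℕ) : ¬ EqE P.eqs (a.bind θ) (b.bind θ) →
      Ready P θ F (.cstr (.ne a b) n) 0

/-- All conditions but disequality hold symbolically modulo `E` and survive any `θ'`; a disequality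
is known only under `θ` and is transferred by `hsep`. -/
theorem Ready.enabled {θ' : Var Sg → GTerm Sg Role} (hθ' : IsSorted θ') (hsep : Separates P θ' θ)
    {y : SMsg (STerm Sg)} {L : Multiset (STerm Sg)} (h : Ready P θ F y L)
    {IK : Multiset (GTerm Sg Role)} (hF : ∀ f ∈ F, Known P IK (f.bind θ'))
    {v : List (SMsg (GTerm Sg Role))}
    (hv : v = [] → ∀ c n, y = .cstr c n → c = .nondet) :
    Enabled P IK v (y.map (Term.bind θ')) := by
  cases h with
  | send a => trivial
  | learn a b => trivial
  | recv a f hf he => exact (hF f hf).of_eqE (he.bind hθ')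
  | nondet n => exact ⟨trivial, fun _ => rfl⟩
  | eq a b n he => exact ⟨he.bind hθ', fun h => nomatch hv h _ _ rfl⟩
  | ne a b n he => exact ⟨fun h => he (hsep _ _ h), fun h => nomatch hv h _ _ rfl⟩

theorem Extends.head_eq_nondet {ro : Role} {i : ℕ} {c : Cstr (GTerm Sg Role)} {n : ℕ}
    (h : Extends P ro i [] (.cstr c n)) : c = .nondet := by
  obtain ⟨pre, post, y, τ, hP, hτ, hv, hy⟩ := h
  cases pre with
  | nil =>
    cases y with
    | out u => cases hy
    | inp u => cases hy
    | cstr d k =>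
      obtain rfl := P.strands_head ro d k post hP
      cases hy
      rfl
  | cons a pre => cases hv

theorem Session.Valid.advance {T : Session Sg Role} (hT : T.Valid P) {y : SMsg (STerm Sg)}
    {l : List (SMsg (STerm Sg))} (hf : T.future = y :: l) (i : ℕ) : (T.advance i y l).Valid P := by
  have e : T.past ++ T.future = T.past ++ [y] ++ l := by simp [hf]
  exact ⟨e ▸ hT.mem, hT.sorted, e ▸ hT.fresh⟩

theorem Session.Named.advance {T : Session Sg Role} {y : SMsg (STerm Sg)}
    {l : List (SMsg (STerm Sg))} (hN : T.Named N) (hf : T.future = y :: l) :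
    (T.advance T.id y l).Named N := by
  have e : T.past ++ T.future = T.past ++ [y] ++ l := by simp [hf]
  intro n hn
  exact hN n (e ▸ hn)

/-- The execution of one element in the ground state, given the step without learning. -/
theorem Ready.exists_ik {θ' : Var Sg → GTerm Sg Role} (hθ' : IsSorted θ')
    {y : SMsg (STerm Sg)} {L : Multiset (STerm Sg)} (h : Ready P θ F y L)
    {IK : Multiset (GTerm Sg Role)} (hF : ∀ f ∈ F, Known P IK (f.bind θ'))
    (hK : ∀ x ∈ IK, ∃ k ∈ K, EqE P.eqs x (k.bind θ'))
    {step : Multiset (GTerm Sg Role) → Prop} (hstep : step IK)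
    (hlearn : ∀ m, y.map (Term.bind θ') = .out m → ¬ Known P IK m → step (m ::ₘ IK)) :
    ∃ IK', step IK' ∧ (∀ f ∈ {f | f ∈ L} ∪ F, Known P IK' (f.bind θ')) ∧
      (∀ x ∈ IK', ∃ k ∈ L + K, EqE P.eqs x (k.bind θ')) := by
  have hzero : ∀ f ∈ {f | f ∈ (0 : Multiset (STerm Sg))} ∪ F, Known P IK (f.bind θ') := by
    rintro f (hf | hf)
    · exact absurd hf (Multiset.notMem_zero f)
    · exact hF f hf
  cases h with
  | learn a b he =>
    have hK' : ∀ x ∈ IK, ∃ k ∈ {b} + K, EqE P.eqs x (k.bind θ') := fun x hx =>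
      let ⟨k, hk, hxk⟩ := hK x hx
      ⟨k, Multiset.mem_add.2 (.inr hk), hxk⟩
    -- If the message is already known under `θ'`, it is sent without being learned; the negative
    -- fact of the symbolic rule need not hold in the ground state.
    by_cases hk : Known P IK (a.bind θ')
    · refine ⟨IK, hstep, ?_, hK'⟩
      rintro f (hf | hf)
      · obtain rfl := Multiset.mem_singleton.1 hf
        exact hk.of_eqE (he.bind hθ')
      · exact hF f hf
    · refine ⟨_, hlearn _ rfl hk, ?_, fun x hx => ?_⟩
      · rintro f (hf | hf)
        · obtain rfl := Multiset.mem_singleton.1 hf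
          exact ⟨_, Multiset.mem_cons_self _ _, he.bind hθ'⟩
        · exact (hF f hf).mono (Multiset.le_cons_self _ _)
      · rcases Multiset.mem_cons.1 hx with rfl | hx
        · exact ⟨b, Multiset.mem_add.2 (.inl (Multiset.mem_singleton_self b)), he.bind hθ'⟩
        · exact hK' x hx
  | _ => exact ⟨IK, hstep, hzero, by simpa only [zero_add] using hK⟩

/-- Execution of an element of a session that has been started. -/
theorem Reach.advance {T : Session Sg Role} (h : Reach P θ s₀ (T ::ₘ W) F K N m)
    {y : SMsg (STerm Sg)} {l : List (SMsg (STerm Sg))} (hf : T.future = y :: l)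
    (hp : T.past ≠ []) {L : Multiset (STerm Sg)}
    (hr : Ready P θ F (y.map (Term.bind T.subst)) L) :
    Reach P θ s₀ (T.advance T.id y l ::ₘ W) ({f | f ∈ L} ∪ F) (L + K) N m where
  valid := Multiset.forall_mem_cons.2 ⟨(h.valid T (Multiset.mem_cons_self _ _)).advance hf _,
    fun U hU => h.valid U (Multiset.mem_cons_of_mem hU)⟩
  nodup := by simpa only [Multiset.cons_bind, Session.advance] using h.nodup
  named := Multiset.forall_mem_cons.2
    ⟨fun _ => (h.named T (Multiset.mem_cons_self _ _) hp).advance hf,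
    fun U hU => h.named U (Multiset.mem_cons_of_mem hU)⟩
  unnamed := Multiset.forall_mem_cons.2 ⟨fun e => by simp [Session.advance] at e,
    fun U hU => h.unnamed U (Multiset.mem_cons_of_mem hU)⟩
  inj := h.inj
  id_le := h.id_le
  run θ' hθ' hN hsep := by
    classical
    obtain ⟨⟨S, IK⟩, hs, hm, hW, hF, hK⟩ := h.run θ' hθ' hN hsep
    rw [Multiset.filter_cons_of_pos (p := fun T => T.past ≠ []) (a := T) _ hp, Multiset.map_cons] at hW
    obtain ⟨U, rfl⟩ := Multiset.le_iff_exists_add.1 hW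
    have hT := h.valid T (Multiset.mem_cons_self _ _)
    have hext := Session.extends hθ' hN hT (h.named T (Multiset.mem_cons_self _ _) hp) hf
    have hv : (T.ground θ').msgs ≠ [] := by simpa [Session.ground] using hp
    have hen := hr.enabled hθ' hsep hF (v := (T.ground θ').msgs) fun e => absurd e hv
    have hg : T.ground θ' = ⟨T.role, T.id, (T.ground θ').msgs⟩ := rfl
    have hg' : (T.advance T.id y l).ground θ' = ⟨T.role, T.id, (T.ground θ').msgs ++
        [(y.map (Term.bind T.subst)).map (Term.bind θ')]⟩ := by
      simp [Session.ground, Session.advance]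
    rw [Multiset.cons_add, hg] at hs
    let SS := (W.filter fun T => T.past ≠ []).map (Session.ground θ') + U
    obtain ⟨IK', hstep, hF', hK'⟩ := hr.exists_ik hθ' hF hK
      (step := fun IK' => FStep P ⟨⟨T.role, T.id, (T.ground θ').msgs⟩ ::ₘ SS, IK⟩
        ⟨⟨T.role, T.id, (T.ground θ').msgs ++
          [(y.map (Term.bind T.subst)).map (Term.bind θ')]⟩ ::ₘ SS, IK'⟩)
      (FStep.of_enabled hv hext hen) (fun z hz hk => by
        rw [hz] at hext ⊢
        exact FStep.sendLearn _ IK T.role T.id _ z hv hext hk)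
    refine ⟨_, hs.tail hstep, fun ro => ?_, ?_, hF', hK'⟩
    -- The extended strand keeps its identifier, so the maxima do not change.
    · rw [← hm ro, Multiset.cons_add, maxStrId_cons, maxStrId_cons]
      rfl
    · rw [Multiset.filter_cons_of_pos _ (by simp [Session.advance]), Multiset.map_cons, hg']
      exact Multiset.cons_le_cons _ (Multiset.le_add_right _ _)

/-- Names for the fresh variables of a session that is started. -/
theorem Reach.exists_names {T : Session Sg Role} (h : Reach P θ s₀ (T ::ₘ W) F K N m) (i : ℕ)
    (hi : m T.role < i) :
    ∃ N' : ℕ → Option (Name Role), (∀ k ∉ T.fresh, N' k = N k) ∧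
      (∀ k ∈ T.fresh, ∃ n, N' k = some ⟨n, T.role, i⟩) ∧
      (∀ k k' a, N' k = some a → N' k' = some a → k = k') ∧
      ({T with id := i} : Session Sg Role).Named N' := by
  classical
  obtain ⟨φ, hinj, himg, hφ⟩ := (h.valid T (Multiset.mem_cons_self _ _)).fresh
  have hmem : ∀ k ∈ T.fresh, ∃ n ∈ freshIdx (T.past ++ T.future), φ n = k := by
    intro k hk
    have : k ∈ φ '' freshIdx (T.past ++ T.future) := himg ▸ hk
    exact this
  -- `g` inverts the renaming `φ`: the name of `k` must be built from the fresh variable of the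
  -- protocol strand, not from `k`.
  choose! g hg hgφ using hmem
  let N' : ℕ → Option (Name Role) := fun k =>
    if k ∈ T.fresh then some ⟨g k, T.role, i⟩ else N k
  -- Earlier names of this role have identifiers at most `m T.role < i`, so old and new names cannot
  -- clash.
  have hold : ∀ k a, N k = some a → a ≠ ⟨a.fvar, T.role, i⟩ := by
    rintro k ⟨n, ro, j⟩ hk e
    simp only [Name.mk.injEq, true_and] at e
    obtain ⟨rfl, rfl⟩ := e
    exact absurd (h.id_le k _ hk) (not_le.2 hi)
  refine ⟨N', fun k hk => if_neg hk, fun k hk => ⟨g k, if_pos hk⟩, ?_, fun n hn => ?_⟩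
  · intro k k' a hk hk'
    by_cases hkT : k ∈ T.fresh <;> by_cases hkT' : k' ∈ T.fresh <;>
      simp only [N', hkT, hkT', if_true, if_false, Option.some.injEq] at hk hk'
    · rw [← hgφ k hkT, ← hgφ k' hkT']
      subst hk
      simp only [Name.mk.injEq, and_true] at hk'
      rw [hk']
    · exact absurd (by rw [← hk]) (hold k' a hk')
    · exact absurd (by rw [← hk']) (hold k a hk)
    · exact h.inj k k' a hk hk'
  · have hT : φ n ∈ T.fresh := by
      have : φ n ∈ (T.fresh : Set ℕ) := himg ▸ Set.mem_image_of_mem φ hn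
      exact this
    refine ⟨φ n, hφ n hn, ?_⟩
    simp only [N', if_pos hT]
    rw [hinj (hg _ hT) hn (hgφ _ hT)]

/-- Execution of the first element of a session. -/
theorem Reach.advance_new {T : Session Sg Role} (h : Reach P θ s₀ (T ::ₘ W) F K N m)
    {y : SMsg (STerm Sg)} {l : List (SMsg (STerm Sg))} (hf : T.future = y :: l)
    (hp : T.past = []) {L : Multiset (STerm Sg)}
    (hr : Ready P θ F (y.map (Term.bind T.subst)) L) :
    ∃ N' m', Reach P θ s₀ (T.advance (m T.role + 1) y l ::ₘ W) ({f | f ∈ L} ∪ F) (L + K) N' m' := by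
  classical
  have hTW := Multiset.mem_cons_self T W
  obtain ⟨N', hN', hNT, hinj, hnamed⟩ := h.exists_names _ (Nat.lt_succ_self _)
  -- The fresh variables of an unstarted session have no names yet, so `N'` extends `N`, and a
  -- substitution that respects `N'` is admissible for the execution so far.
  have hext : ∀ k a, N k = some a → N' k = some a := fun k a hk => by
    rw [hN' k fun hkT => by simp [h.unnamed T hTW hp k hkT] at hk, hk]
  have hdisj := h.nodup
  rw [Multiset.cons_bind, Multiset.nodup_add] at hdisj
  refine ⟨N', Function.update m T.role (m T.role + 1), ?_⟩
  refine ⟨?_, ?_, ?_, ?_, hinj, ?_, ?_⟩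
  · exact Multiset.forall_mem_cons.2 ⟨(h.valid T hTW).advance hf _,
      fun U hU => h.valid U (Multiset.mem_cons_of_mem hU)⟩
  · simpa only [Multiset.cons_bind, Session.advance] using h.nodup
  · refine Multiset.forall_mem_cons.2 ⟨fun _ => hnamed.advance hf, fun U hU hUp n hn => ?_⟩
    obtain ⟨k, hk, hkN⟩ := h.named U (Multiset.mem_cons_of_mem hU) hUp n hn
    exact ⟨k, hk, hext _ _ hkN⟩
  · refine Multiset.forall_mem_cons.2 ⟨fun e => by simp [Session.advance] at e,
      fun U hU hUp k hk => ?_⟩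
    -- Sessions have disjoint fresh variables, so starting one names none of another.
    rw [hN' k fun hkT => Multiset.disjoint_left.1 hdisj.2.2 hkT
      (Multiset.mem_bind.2 ⟨U, hU, hk⟩)]
    exact h.unnamed U (Multiset.mem_cons_of_mem hU) hUp k hk
  · intro k a hk
    by_cases hkT : k ∈ T.fresh
    · obtain ⟨n, hn⟩ := hNT k hkT
      obtain rfl := Option.some.inj (hk.symm.trans hn)
      simp
    · refine (h.id_le k a (hN' k hkT ▸ hk)).trans ?_
      by_cases hro : a.role = T.role
      · simp [hro]
      · simp [hro]
  · intro θ' hθ' hNθ hsep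
    obtain ⟨⟨S, IK⟩, hs, hm, hW, hF, hK⟩ :=
      h.run θ' hθ' (fun k a hk => hNθ k a (hext k a hk)) hsep
    rw [Multiset.filter_cons_of_neg _ (by simp [hp])] at hW
    have hT := h.valid T hTW
    have hT' : ({T with id := m T.role + 1} : Session Sg Role).Valid P :=
      ⟨hT.mem, hT.sorted, hT.fresh⟩
    have hx := Session.extends hθ' hNθ hT' hnamed hf
    have hv : (({T with id := m T.role + 1} : Session Sg Role).ground θ').msgs = [] := by
      simp [Session.ground, hp]
    rw [hv] at hx
    simp only at hx hm hF hK
    rw [← hm T.role] at hx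
    have hen := hr.enabled hθ' hsep hF (v := []) fun _ c n hc => by
      rw [hc] at hx
      have := hx.head_eq_nondet
      cases c with
      | nondet => rfl
      | eq a b => cases this
      | ne a b => cases this
    obtain ⟨IK', hstep, hF', hK'⟩ := hr.exists_ik hθ' hF hK
      (step := fun IK' => FStep P ⟨S, IK⟩ ⟨⟨T.role, maxStrId S T.role + 1,
        [(y.map (Term.bind T.subst)).map (Term.bind θ')]⟩ ::ₘ S, IK'⟩)
      (FStep.new_of_enabled hx hen) (fun z hz hk => by
        rw [hz] at hx ⊢
        exact FStep.newSendLearn _ IK T.role z hx hk)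
    refine ⟨_, hs.tail hstep, fun ro => ?_, ?_, hF', hK'⟩
    · rw [maxStrId_cons]
      by_cases hro : T.role = ro
      · subst hro
        simp [hm]
      · simp [hro, hm, Ne.symm hro]
    · rw [Multiset.filter_cons_of_pos _ (by simp [Session.advance]), Multiset.map_cons]
      have hg' : (T.advance (m T.role + 1) y l).ground θ' = ⟨T.role, maxStrId S T.role + 1,
          [(y.map (Term.bind T.subst)).map (Term.bind θ')]⟩ := by
        simp [Session.ground, Session.advance, hp, hm]
      rw [hg']
      exact Multiset.cons_le_cons _ hW

/-! ### Replaying the narrowing sequence forwards -/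

/-- A symbolic strand describes a session, when its variables are instantiated by `ν`. -/
structure SStrand.Describes (P : Protocol Sg Role) (ν : Var Sg → STerm Sg) (st : SStrand Sg Role)
    (T : Session Sg Role) : Prop where
  role : st.role = T.role
  past : MsgsEq P.eqs (bindMsgs ν st.past) (bindMsgs T.subst T.past)
  future : MsgsEq P.eqs (bindMsgs ν st.future) (bindMsgs T.subst T.future)

/-- The symbolic state `C`, when its variables are instantiated by `ν`, describes a state reached
by an execution in which the intruder learns at most `K`. -/
def Simulates (P : Protocol Sg Role) (θ : Var Sg → GTerm Sg Role) (s₀ : GState Sg Role)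
    (C : CState Sg Role) (ν : Var Sg → STerm Sg) (K : Multiset (STerm Sg)) : Prop :=
  IsSorted ν ∧ ∃ W F N m, Multiset.Rel (SStrand.Describes P ν) C.strands W ∧
    (∀ a, IFact.pos a ∈ C.facts → ∃ f ∈ F, EqE P.eqs f (a.bind ν)) ∧
    (∀ d ∈ C.store, ¬ EqE P.eqs ((d.1.bind ν).bind θ) ((d.2.bind ν).bind θ)) ∧
    Reach P θ s₀ W F K N m

theorem SStrand.IsInstance.exists_session {st : SStrand Sg Role} (h : st.IsInstance P)
    (hp : st.past = []) : ∃ T : Session Sg Role, T.Valid P ∧ T.past = [] ∧ T.fresh = st.fresh ∧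
      st.Describes P Term.leaf T := by
  obtain ⟨l, ρ, hl, hρ, hfr, heq⟩ := h
  refine ⟨⟨st.role, 0, st.fresh, ρ, [], l⟩, ⟨hl, hρ, hfr⟩, rfl, rfl, ⟨rfl, ?_, ?_⟩⟩
  · rw [hp]
    exact .nil
  · rw [hp] at heq
    rw [bindMsgs_leaf]
    exact MsgsEq.symm heq

/-- The sessions keep the fresh variables of their strands, so the disjointness required of symbolic
states passes to them. -/
theorem exists_sessions (S : Multiset (SStrand Sg Role)) (h : ∀ st ∈ S, st.IsInstance P)
    (hp : ∀ st ∈ S, st.past = []) : ∃ W : Multiset (Session Sg Role), (∀ T ∈ W, T.Valid P) ∧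
      (∀ T ∈ W, T.past = []) ∧
      (W.bind fun T => T.fresh.val) = (S.bind fun st => st.fresh.val) ∧
      Multiset.Rel (SStrand.Describes P Term.leaf) S W := by
  induction S using Multiset.induction_on with
  | empty => exact ⟨0, by simp, by simp, by simp, .zero⟩
  | cons st S ih =>
    rw [Multiset.forall_mem_cons] at h hp
    obtain ⟨W, h₁, h₂, h₃, h₄⟩ := ih h.2 hp.2
    obtain ⟨T, k₁, k₂, k₃, k₄⟩ := h.1.exists_session hp.1
    refine ⟨T ::ₘ W, Multiset.forall_mem_cons.2 ⟨k₁, h₁⟩, Multiset.forall_mem_cons.2 ⟨k₂, h₂⟩, ?_,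
      .cons k₄ h₄⟩
    rw [Multiset.cons_bind, Multiset.cons_bind, h₃, k₃]

theorem Simulates.start {C : CState Sg Role} (hC : C.IsSymbolic P) (hCi : C.IsInitial)
    (hs₀ : s₀.IsInitial) (hl : Lifts P C θ s₀) : Simulates P θ s₀ C Term.leaf 0 := by
  obtain ⟨W, h₁, h₂, h₃, h₄⟩ := exists_sessions C.strands hC.inst hCi.1
  refine ⟨IsSorted.leaf, W, ∅, _, _, h₄, fun a ha => absurd ha (hCi.2 a), fun d hd => ?_,
    Reach.start hs₀ h₁ (h₃ ▸ hC.fresh_disjoint) h₂⟩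
  rw [Term.bind_leaf, Term.bind_leaf]
  exact hl.store d hd

/-- Narrowing: an instance of `C'` equals `D` modulo `E`. -/
theorem Simulates.of_eqMod {C' D : CState Sg Role} {μ ν : Var Sg → STerm Sg}
    (h : Simulates P θ s₀ D ν K) (hθ : IsSorted θ) (hμ : IsSorted μ)
    {X : Multiset (SStrand Sg Role)} {Y : Multiset (IFact (STerm Sg))}
    (he : (C'.subst μ X Y).EqMod P.eqs D) :
    Simulates P θ s₀ C' (fun x => (μ x).bind ν) K := by
  obtain ⟨hν, W, F, N, m, hW, hF, hΨ, hR⟩ := h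
  obtain ⟨hes, hef, hed⟩ := he
  -- `S₂` and its sessions `W₂` correspond to the instance `X` of `SS`; they are dropped.
  obtain ⟨S₁, S₂, hS₁, -, hS⟩ := Multiset.rel_add_left.1 hes
  rw [hS] at hW
  obtain ⟨W₁, W₂, hW₁, -, rfl⟩ := Multiset.rel_add_left.1 hW
  refine ⟨hμ.bind hν, W₁, F, N, m, ?_, fun a ha => ?_, fun d hd => ?_,
    hR.of_le (Multiset.le_add_right _ _)⟩
  · have := Multiset.rel_map_left.1 hS₁
    clear hS₁ hW hS hes hR
    generalize C'.strands = S at this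
    induction this generalizing W₁ with
    | zero => rw [Multiset.rel_zero_left.1 hW₁]; exact .zero
    | cons hab _ ih =>
      obtain ⟨T, U, hT, hU, rfl⟩ := Multiset.rel_cons_left.1 hW₁
      refine .cons ⟨hab.role.trans hT.role, ?_, ?_⟩ (ih _ hU)
      · rw [← bindMsgs_bindMsgs]
        exact (MsgsEq.bind hab.past hν).trans hT.past
      · rw [← bindMsgs_bindMsgs]
        exact (MsgsEq.bind hab.future hν).trans hT.future
  · obtain ⟨b, hb, hab⟩ := Multiset.exists_mem_of_rel_of_mem hef
      (Multiset.mem_add.2 (.inl (Multiset.mem_map_of_mem _ ha)))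
    cases hab with
    | pos e =>
      obtain ⟨f, hf, hfe⟩ := hF _ hb
      refine ⟨f, hf, hfe.trans ?_⟩
      rw [← Term.bind_bind]
      exact e.symm.bind hν
  · obtain ⟨b, hb, e₁, e₂⟩ := Multiset.exists_mem_of_rel_of_mem hed (Multiset.mem_map_of_mem _ hd)
    intro h
    rw [← Term.bind_bind, ← Term.bind_bind] at h
    exact hΨ b hb ((((e₁.bind hν).bind hθ).symm.trans h).trans ((e₂.bind hν).bind hθ))

/-- The next element of the session described by the first symbolic strand. -/
theorem SStrand.Describes.exists_advance {ν : Var Sg → STerm Sg} {ro : Role} {fr : Finset ℕ}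
    {L L' : List (SMsg (STerm Sg))} {x : SMsg (STerm Sg)} {SS : Multiset (SStrand Sg Role)}
    (hW : Multiset.Rel (SStrand.Describes P ν) (⟨ro, fr, L, x :: L'⟩ ::ₘ SS) W)
    (hR : Reach P θ s₀ W F K N m) {A : Multiset (STerm Sg)}
    (hr : ∀ y, SMsg.Rel (EqE P.eqs) (x.map (Term.bind ν)) y → Ready P θ F y A) :
    ∃ W' N' m', Multiset.Rel (SStrand.Describes P ν) (⟨ro, fr, L ++ [x], L'⟩ ::ₘ SS) W' ∧
      Reach P θ s₀ W' ({f | f ∈ A} ∪ F) (A + K) N' m' := by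
  obtain ⟨T, W, hT, hSS, rfl⟩ := Multiset.rel_cons_left.1 hW
  have hfut : MsgsEq P.eqs (bindMsgs ν (x :: L')) (bindMsgs T.subst T.future) := hT.future
  rcases hf : T.future with _ | ⟨y, l⟩
  · rw [hf] at hfut
    cases hfut
  rw [hf] at hfut
  obtain ⟨hxy, hl⟩ := List.forall₂_cons.1 hfut
  have hadv : ∀ i, SStrand.Describes P ν ⟨ro, fr, L ++ [x], L'⟩ (T.advance i y l) := fun i => by
    refine ⟨hT.role, ?_, hl⟩
    simp only [bindMsgs, List.map_append, Session.advance]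
    exact List.rel_append hT.past (.cons hxy .nil)
  by_cases hp : T.past = []
  · obtain ⟨N', m', h⟩ := hR.advance_new hf hp (hr _ hxy)
    exact ⟨_, N', m', .cons (hadv _) hSS, h⟩
  · exact ⟨_, N, m, .cons (hadv _) hSS, hR.advance hf hp (hr _ hxy)⟩

theorem Simulates.rule {C D : CState Sg Role} {ν : Var Sg → STerm Sg} {K₁ : Multiset (STerm Sg)}
    (hθ : IsSorted θ) (h : Simulates P θ s₀ C ν K) (hrule : BRule P C K₁ D) :
    Simulates P θ s₀ D ν (K₁.map (Term.bind ν) + K) := by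
  obtain ⟨hν, W, F, N, m, hW, hF, hΨ, hR⟩ := h
  have hlearned : ∀ (M : STerm Sg) (IK : Multiset (IFact (STerm Sg))),
      (∀ a, IFact.pos a ∈ IFact.neg M ::ₘ IK → ∃ f ∈ F, EqE P.eqs f (a.bind ν)) →
      ∀ a, IFact.pos a ∈ IFact.pos M ::ₘ IK →
        ∃ f ∈ {f | f ∈ ({M.bind ν} : Multiset (STerm Sg))} ∪ F, EqE P.eqs f (a.bind ν) := by
    intro M IK hIK a ha
    rcases Multiset.mem_cons.1 ha with e | ha
    · cases e
      exact ⟨_, .inl (Multiset.mem_singleton_self _), .refl _⟩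
    · obtain ⟨f, hf, hfa⟩ := hIK a (Multiset.mem_cons_of_mem ha)
      exact ⟨f, .inr hf, hfa⟩
  have hready : ∀ (M : STerm Sg) (y : SMsg (STerm Sg)),
      SMsg.Rel (EqE P.eqs) ((SMsg.out M).map (Term.bind ν)) y → Ready P θ F y {M.bind ν} := by
    intro M y hy
    cases hy with
    | out e => exact .learn _ _ e.symm
  have hold : ∀ IK : Multiset (IFact (STerm Sg)),
      (∀ a, IFact.pos a ∈ IK → ∃ f ∈ F, EqE P.eqs f (a.bind ν)) →
      ∀ a, IFact.pos a ∈ IK →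
        ∃ f ∈ {f | f ∈ (0 : Multiset (STerm Sg))} ∪ F, EqE P.eqs f (a.bind ν) :=
    fun IK hIK a ha => let ⟨f, hf, hfa⟩ := hIK a ha; ⟨f, .inr hf, hfa⟩
  cases hrule with
  | recv SS IK Ψ ro fr L L' M =>
    obtain ⟨W', N', m', hW', hR'⟩ := SStrand.Describes.exists_advance hW hR (A := 0) fun y hy => by
      cases hy with
      | inp e =>
        obtain ⟨f, hf, hfM⟩ := hF M (Multiset.mem_cons_self _ _)
        exact .recv _ f hf (hfM.trans e)
    exact ⟨hν, W', _, N', m', hW', hold _ hF, hΨ, hR'⟩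
  | send SS IK Ψ ro fr L L' M =>
    obtain ⟨W', N', m', hW', hR'⟩ := SStrand.Describes.exists_advance hW hR (A := 0) fun y hy => by
      cases hy with
      | out e => exact .send _
    exact ⟨hν, W', _, N', m', hW', hold _ hF, hΨ, hR'⟩
  | sendLearn SS IK Ψ ro fr L L' M =>
    obtain ⟨W', N', m', hW', hR'⟩ := SStrand.Describes.exists_advance hW hR (hready M)
    exact ⟨hν, W', _, N', m', hW', hlearned M IK hF, hΨ, hR'⟩
  | newStrand SS IK Ψ ro fr l₁ l₂ u' ρ hP hρ hfr =>
    obtain ⟨W', N', m', hW', hR'⟩ := SStrand.Describes.exists_advance hW hR (hready _)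
    -- The right-hand side of (B&) no longer shows the strand: its session is executed and then
    -- forgotten, while the message stays in the known set.
    obtain ⟨T, W'', -, hW'', rfl⟩ := Multiset.rel_cons_left.1 hW'
    exact ⟨hν, W'', _, N', m', hW'', hlearned _ IK hF, hΨ,
      hR'.of_le (Multiset.le_cons_self _ _)⟩
  | choice SS IK Ψ ro fr L L' num =>
    obtain ⟨W', N', m', hW', hR'⟩ := SStrand.Describes.exists_advance hW hR (A := 0) fun y hy => by
      cases hy with
      | cstr n e =>
        cases e
        exact .nondet _
    exact ⟨hν, W', _, N', m', hW', hold _ hF, hΨ, hR'⟩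
  | ifEq SS IK Ψ ro fr L L' M num =>
    obtain ⟨W', N', m', hW', hR'⟩ := SStrand.Describes.exists_advance hW hR (A := 0) fun y hy => by
      cases hy with
      | cstr n e =>
        cases e with
        | eq e₁ e₂ => exact .eq _ _ _ (e₁.symm.trans e₂)
    exact ⟨hν, W', _, N', m', hW', hold _ hF, hΨ, hR'⟩
  | ifNe SS IK Ψ ro fr L L' M M' num hsat =>
    obtain ⟨W', N', m', hW', hR'⟩ := SStrand.Describes.exists_advance hW hR (A := 0) fun y hy => by
      cases hy with
      | cstr n e =>
        cases e with
        | ne e₁ e₂ =>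
          -- The store of the left-hand side still contains this disequality, true under `ν`
          -- followed by `θ`.
          exact .ne _ _ _ fun h => hΨ _ (Multiset.mem_cons_self _ _)
            (((e₁.bind hθ).trans h).trans (e₂.bind hθ).symm)
    exact ⟨hν, W', _, N', m', hW', hold _ hF, fun d hd => hΨ d (Multiset.mem_cons_of_mem hd), hR'⟩

/-- The constructor `step` adds a step at the end of `C'`, so the induction starts at `C₀` and
follows the forward execution. -/
theorem NarrowStar.simulates {C₀ C' : CState Sg Role} {μ : Var Sg → STerm Sg}
    (h : NarrowStar P C' μ K C₀) (hC₀ : C₀.IsSymbolic P) (hC₀i : C₀.IsInitial)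
    (hs₀ : s₀.IsInitial) (hl : Lifts P C₀ θ s₀) : Simulates P θ s₀ C' μ K := by
  induction h with
  | refl C => exact Simulates.start hC₀ hC₀i hs₀ hl
  | step hstep _ ih =>
    obtain ⟨hμ, -, X, Y, D', he, hrule, -⟩ := hstep
    exact ((ih hC₀ hC₀i hl).rule hl.sorted hrule).of_eqMod hl.sorted hμ he

/-! ### The ground substitution with the right names -/

/-- A substitution with given distinct names for some fresh variables that identifies no more
terms than `θ`: all other names in the image of `θ` are replaced by new ones. -/
theorem exists_respects_separates (hθ : IsSorted θ)
    (hinj : ∀ k k' a, N k = some a → N k' = some a → k = k')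
    (hid : ∀ k a, N k = some a → a.id ≤ m a.role) :
    ∃ θ' : Var Sg → GTerm Sg Role, IsSorted θ' ∧ Respects N θ' ∧ Separates P θ' θ := by
  classical
  -- By `hid`, shifted identifiers exceed all those in the range of `N`.
  let shift : Name Role → GTerm Sg Role := fun a => .leaf ⟨a.fvar, a.role, a.id + m a.role + 1⟩
  -- Undoes `θ'`: a name in the range of `N` returns to the value under `θ` of its variable, unique
  -- by `hinj`, and shifted names are shifted back. Truncation of the subtraction can affect only
  -- names that are not shifted ones, where the value is irrelevant.
  let back : Name Role → GTerm Sg Role := fun a =>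
    if h : ∃ k, N k = some a then θ (Var.ofFresh Sg h.choose)
    else .leaf ⟨a.fvar, a.role, a.id - (m a.role + 1)⟩
  let θ' : Var Sg → GTerm Sg Role := fun x =>
    if h : x.sort = Sg.fresh ∧ ∃ a, N x.idx = some a then .leaf h.2.choose else (θ x).bind shift
  have hshift : IsSorted shift := fun a => .leaf _ _ le_rfl
  have hback : IsSorted back := fun a => by
    by_cases h : ∃ k, N k = some a
    · simp only [back, dif_pos h]
      exact hθ (Var.ofFresh Sg h.choose)
    · simp only [back, dif_neg h]
      exact .leaf _ _ le_rfl
  have hback_shift : ∀ a, (shift a).bind back = .leaf a := fun a => by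
    have h : ¬ ∃ k, N k = some (⟨a.fvar, a.role, a.id + m a.role + 1⟩ : Name Role) := by
      rintro ⟨k, hk⟩
      have := hid k _ hk
      simp only at this
      omega
    simp only [shift, Term.bind, back, dif_neg h]
    rw [show a.id + m a.role + 1 - (m a.role + 1) = a.id by omega]
  have hθ'_back : ∀ x, (θ' x).bind back = θ x := by
    rintro ⟨s, n⟩
    by_cases h : s = Sg.fresh ∧ ∃ a, N n = some a
    · have hex : ∃ k, N k = some h.2.choose := ⟨n, h.2.choose_spec⟩
      simp only [θ', dif_pos h, Term.bind, back, dif_pos hex]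
      rw [hinj _ _ _ hex.choose_spec h.2.choose_spec, h.1]
      rfl
    · simp only [θ', dif_neg h]
      rw [Term.bind_bind]
      simp only [hback_shift]
      exact Term.bind_leaf _
  refine ⟨θ', fun x => ?_, fun k a hk => ?_, fun a b h => ?_⟩
  · by_cases h : x.sort = Sg.fresh ∧ ∃ a, N x.idx = some a
    · simp only [θ', dif_pos h]
      exact .leaf _ _ h.1.ge
    · simp only [θ', dif_neg h]
      exact (hθ x).bind hshift
  · have h : (Var.ofFresh Sg k).sort = Sg.fresh ∧ ∃ a, N (Var.ofFresh Sg k).idx = some a :=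
      ⟨rfl, a, hk⟩
    simp only [θ', dif_pos h]
    rw [Option.some.inj (h.2.choose_spec.symm.trans hk)]
  · have := h.bind hback
    rw [Term.bind_bind, Term.bind_bind] at this
    simpa only [hθ'_back] using this

end Simulation

/-! ### Soundness -/

theorem mainTheorem3 {Sg : Signature.{u, v}} {Role : Type r} (P : Protocol Sg Role)
    (C₀ C' : CState Sg Role) (s₀ : GState Sg Role) (θ : Var Sg → GTerm Sg Role)
    (μ : Var Sg → STerm Sg) (K : Multiset (STerm Sg))
    (hC₀ : C₀.IsSymbolic P) (hC' : C'.IsSymbolic P)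
    (hs₀ : s₀.IsGround P) (hs₀_init : s₀.IsInitial)
    (hC₀_init : C₀.IsInitial)
    (hnarrow : NarrowStar P C' μ K C₀)
    (hlift : Lifts P C₀ θ s₀)
    (hcons : ∀ m, IFact.neg m ∈ C'.facts → ∀ k ∈ K,
      ¬ EqE P.eqs ((m.bind μ).bind θ) (k.bind θ)) :
    ∃ (s' : GState Sg Role) (θ' : Var Sg → GTerm Sg Role),
      s'.IsGround P ∧ Relation.ReflTransGen (FStep P) s₀ s' ∧ Lifts P C' θ' s' := by
  obtain ⟨hμ, W, F, N, m, hW, hF, hΨ, hR⟩ := hnarrow.simulates hC₀ hC₀_init hs₀_init hlift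
  -- All names are now fixed, so the ground substitution can be chosen.
  obtain ⟨θ', hθ', hN, hsep⟩ :=
    exists_respects_separates (P := P) hlift.sorted hR.inj hR.id_le
  obtain ⟨s, hs, -, hWs, hFs, hKs⟩ := hR.run θ' hθ' hN hsep
  have hground : s.IsGround P := by
    clear hWs hFs hKs
    induction hs with
    | refl => exact hs₀
    | tail _ hstep ih => exact hstep.isGround ih
  refine ⟨s, fun x => (μ x).bind θ', hground, hs, hμ.bind hθ', fun st hst hp => ?_,
    fun a ha => ?_, fun a ha hk => ?_, fun d hd h => ?_⟩
  · obtain ⟨T, hT, hd⟩ := Multiset.exists_mem_of_rel_of_mem hW hst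
    have hTp : T.past ≠ [] := fun e => by
      have := hd.past
      rw [e] at this
      exact hp (List.map_eq_nil_iff.1 (List.forall₂_nil_right_iff.1 this))
    refine ⟨T.ground θ', Multiset.mem_of_le hWs (Multiset.mem_map_of_mem _
      (Multiset.mem_filter.2 ⟨hT, hTp⟩)), hd.role.symm, ?_⟩
    have := (hd.past.symm).bind hθ'
    rw [bindMsgs_bindMsgs μ] at this
    exact this
  · obtain ⟨f, hf, hfa⟩ := hF a ha
    rw [← Term.bind_bind]
    exact (hFs f hf).of_eqE (hfa.bind hθ')
  -- A known instance of a negative fact would equal a learned message under `θ'`, hence under `θ`,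
  -- against `hcons`.
  · obtain ⟨x, hx, hxa⟩ := hk
    obtain ⟨k, hkK, hxk⟩ := hKs x hx
    rw [← Term.bind_bind] at hxa
    exact hcons a ha k hkK (hsep _ _ (hxa.symm.trans hxk))
  · rw [← Term.bind_bind, ← Term.bind_bind] at h
    exact hΨ d hd (hsep _ _ h)
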